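/- **Conventions.** Put $\langle\xi\rangle=1+|\xi|$ and $\widehat g(\xi)=\int_{\mathbb R}e^{-ix\xi}g(x)\,dx$ (extended to $L^2(\mathbb R)$ by Plancherel). For $\sigma\ge 0$ let $\|g\|_{H^\sigma(\mathbb R)}=\|\langle\xi\rangle^\sigma\widehat g\|_{L^2}$, and for complex-valued $h$ on $\mathbb R^+=(0,\infty)$ let $\|h\|_{H^\sigma(\mathbb R^+)}=\inf\{\|g\|_{H^\sigma(\mathbb R)}: g=h \text{ a.e. on }(0,\infty)\}$. Let $\rho:\mathbb R\to\mathbb R$ be smooth, supported in $(-2,\infty)$, with $\rho=1$ on $[0,\infty)$, and let $\eta\in C_c^\infty(\mathbb R)$ be real-valued with $\eta=1$ on $[-1,1]$. For $h\in H^\sigma(\mathbb R^+)$ define, for $x,t\in\mathbb R$, $$W_1h(x,t)=\frac{3}{2\pi}\int_0^\infty e^{\beta\left[-\frac{\sqrt3}{2}-\frac12 i\right]x}\,e^{i\beta^3t}\,\rho(\beta x)\,\beta^2\,\widehat h(\beta^3)\,d\beta ,$$ where $\widehat h$ denotes the Fourier transform of $\chi_{[0,\infty)}h$ and, for each $x$,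 the integral is understood as the limit in $L^2_t(\mathbb R)$ of the integrals over $0<\beta\le R$ as $R\to\infty$. **Proposition 4.8.** Let $0\le s<\frac72$, $s\ne\frac12$. There is a constant $C$, depending only on $s,\rho,\eta$, such that for every $h\in H^{\frac{s+1}{3}}(\mathbb R^+)$, with $h(0)=0$ (for the continuous representative of $h$ on $[0,\infty)$) if $s>\frac12$: the function $W_1h(x,\cdot)$ is well defined in $L^2_t(\mathbb R)$ for every $x\in\mathbb R$; if $x\neq0$ or $s>\frac12$ the integral converges absolutely for every $t$ and agrees with $W_1h(x,t)$ for almost every $t$; the map $x\mapsto\eta\,W_1h(x,\cdot)$ is continuous from $\mathbb R$ to $H^{\frac{s+1}{3}}(\mathbb R)$; and $$\sup_{x\in\mathbb R}\big\|\eta\,W_1h(x,\cdot)\big\|_{H^{\frac{s+1}{3}}_t(\mathbb R)}\le C\,\|h\|_{H^{\frac{s+1}{3}}(\mathbb R^+)} .$$ -/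

import Mathlib

open MeasureTheory Set Filter Topology
open scoped ENNReal NNReal ContDiff

noncomputable section

/-- The Japanese bracket `⟨ξ⟩ = 1 + |ξ|`. -/
def japaneseBracket (ξ : ℝ) : ℝ := 1 + |ξ|

open Classical in
/-- The Fourier--Plancherel transform with the convention `ĝ(ξ) = ∫ e^{-i x ξ} g(x) dx` of a square
integrable function `g` (a representative of an `L²` class).  Mathlib's transform has the kernel
`e^{-2π i x ξ}`, whence the rescaling of the variable.
The value `0` for `g ∉ L²` is never used. -/
def fourierL2 (g : ℝ → ℂ) (ξ : ℝ) : ℂ :=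
  if hg : MemLp g 2 (volume : Measure ℝ) then
    (FourierTransform.fourier (hg.toLp g) : Lp (α := ℝ) ℂ 2) (ξ / (2 * Real.pi))
  else 0

open Classical in
/-- The norm `‖⟨ξ⟩^σ ĝ(ξ)‖_{L²}` of `H^σ(ℝ)`, for an order `σ ≥ 0`, as an extended nonnegative
number: it is finite exactly if `g ∈ H^σ(ℝ)`.  (For `σ ≥ 0` one has `H^σ(ℝ) ⊆ L²(ℝ)`.) -/
def sobolevNorm (σ : ℝ) (g : ℝ → ℂ) : ℝ≥0∞ :=
  if MemLp g 2 (volume : Measure ℝ) then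
    eLpNorm (fun ξ : ℝ => ((japaneseBracket ξ ^ σ : ℝ) : ℂ) * fourierL2 g ξ) 2 volume
  else ⊤

/-- The norm of `H^σ(ℝ⁺)`, `ℝ⁺ = (0,∞)`: the infimum of the `H^σ(ℝ)` norms of all extensions.
Only the values of `h` on `(0,∞)` matter, and only almost everywhere.  The norm is finite exactly
if `h` has an extension in `H^σ(ℝ)`, that is, if `h ∈ H^σ(ℝ⁺)`. -/
def halfLineSobolevNorm (σ : ℝ) (h : ℝ → ℂ) : ℝ≥0∞ :=
  ⨅ (g : ℝ → ℂ) (_ : g =ᵐ[volume.restrict (Ioi (0 : ℝ))] h), sobolevNorm σ g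

/-- `h ∈ H^σ(ℝ⁺)`. -/
def MemHalfLineSobolev (σ : ℝ) (h : ℝ → ℂ) : Prop :=
  halfLineSobolevNorm σ h ≠ ⊤

/-- `h(0) = 0` in the sense of traces: the continuous representative of `h` on `[0,∞)` vanishes
at `0`. -/
def VanishesAtZero (h : ℝ → ℂ) : Prop :=
  ∃ g : ℝ → ℂ, ContinuousOn g (Ici 0) ∧ g =ᵐ[volume.restrict (Ioi (0 : ℝ))] h ∧ g 0 = 0

/-- The transform `ĥ = 𝓕_t[χ_{[0,∞)} h]` of boundary data `h` on the half line. -/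
def boundaryTransform (h : ℝ → ℂ) : ℝ → ℂ :=
  fourierL2 ((Ici (0 : ℝ)).indicator h)

/-- The integrand
`e^{β(-√3/2 - i/2)x} e^{iβ³t} ρ(βx) β² ĥ(β³)` of the boundary term. -/
def boundaryIntegrand (ρ : ℝ → ℝ) (h : ℝ → ℂ) (x t β : ℝ) : ℂ :=
  Complex.exp ((β : ℂ) * (-((Real.sqrt 3 / 2 : ℝ) : ℂ) - (1 / 2 : ℂ) * Complex.I) * (x : ℂ))
    * Complex.exp (Complex.I * (β : ℂ) ^ 3 * (t : ℂ))
    * (ρ (β * x) : ℂ) * (β : ℂ) ^ 2 * boundaryTransform h (β ^ 3)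

/-- The boundary integral over the frequencies in a set `S ⊆ (0,∞)`,
`(3/2π) ∫_S e^{β(-√3/2 - i/2)x} e^{iβ³t} ρ(βx) β² ĥ(β³) dβ`. For `S = (0,∞)` this is the formula
for `W₁h(x,t)`. -/
def boundaryIntegral (ρ : ℝ → ℝ) (h : ℝ → ℂ) (S : Set ℝ) (x t : ℝ) : ℂ :=
  (3 / (2 * (Real.pi : ℂ))) * ∫ β in S, boundaryIntegrand ρ h x t β

/-- `u` is the boundary term `W₁h`: for every `x`, the function `u(x,·)` is the integral over
`0 < β < ∞`, read as the limit in `L²_t` of the integrals over `0 < β ≤ R` as `R → ∞` (the usual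
meaning of an inverse Fourier integral of an `L²` function; it is needed at `x = 0`, where the
integral need not converge absolutely).  This determines each `u(x,·)` almost everywhere. -/
def IsBoundaryTerm (ρ : ℝ → ℝ) (h : ℝ → ℂ) (u : ℝ → ℝ → ℂ) : Prop :=
  ∀ x : ℝ, MemLp (u x) 2 (volume : Measure ℝ) ∧
    Tendsto (fun R : ℝ =>
        eLpNorm (fun t : ℝ => u x t - boundaryIntegral ρ h (Ioc 0 R) x t) 2 volume)
      atTop (𝓝 0)

/-- `v ∈ C⁰_x H^σ_t`: each `v(x,·)` is in `H^σ(ℝ)` and `x ↦ v(x,·)` is continuous from `ℝ` to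
`H^σ(ℝ)`. -/
def MemCxHt (σ : ℝ) (v : ℝ → ℝ → ℂ) : Prop :=
  (∀ x : ℝ, sobolevNorm σ (v x) ≠ ⊤) ∧
    ∀ x₀ : ℝ, Tendsto (fun x : ℝ => sobolevNorm σ (fun t => v x t - v x₀ t)) (𝓝 x₀) (𝓝 0)

/-- The norm `sup_x ‖v(x,·)‖_{H^σ}` of `C⁰_x H^σ_t`. -/
def normCxHt (σ : ℝ) (v : ℝ → ℝ → ℂ) : ℝ≥0∞ :=
  ⨆ x : ℝ, sobolevNorm σ (v x)

end

/-! Substitute `ξ = β³ / 2π`. The boundary term at `x` then becomes an inverse Fourier integral in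
`t` over `ξ > 0`, whose transform is that of `χ_{[0,∞)} h` times the multiplier `boundaryProfile ρ
(βx)`. The profile `e^{-(√3/2 + i/2)y} ρ(y)` is bounded: `ρ` cuts it off on the left and the
exponential decays on the right. So for every `x` the `H^σ` norm is at most a constant times that of
`χ_{[0,∞)} h`; continuity in `x` is dominated convergence, and multiplication by `η` is bounded on
`H^σ`.

What remains is that extension by zero is bounded from `H^σ(ℝ⁺)` to `H^σ(ℝ)` for `σ = (s+1)/3`, with
zero trace when `σ > 1/2` (`sobolevNorm_indicator_le`). For `0 < σ < 2` the homogeneous seminorm is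
a multiple of `∫∫ |Δ²_h g|² h^{-1-2σ}` (`diffEnergy_eq`); first differences would stop at `σ < 1`,
while `σ` may approach `3/2`. Cutting off at the origin changes the second differences only at
points within reach of the origin, and the error is the Hardy integral `∫₀^∞ |g|² x^{-2σ}`
(`diffEnergy_indicator_le`).

Hardy's inequality has two proofs. For `σ < 1/2`, `g(x)` is expressed by a second difference and by
values of `g` at large dilates of `x`, whose weighted norms are small and are absorbed
(`hardyIntegral_le_of_lt_half`). For `1/2 < σ < 3/2`, the zero trace gives `|g(x)| ≤ ∫ min(2,
2πx|ξ|) |ĝ(ξ)| dξ`, and Schur's test applies to this homogeneous kernel (`hardy_schur`). -/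

noncomputable section

open FourierTransform SchwartzMap

/-! ### The Plancherel transform on `L²(ℝ)`. -/

open Classical in
/-- The Fourier transform of a square integrable function, in Mathlib's normalization. -/
def plancherel (g : ℝ → ℂ) : ℝ → ℂ :=
  if hg : MemLp g 2 (volume : Measure ℝ) then
    (FourierTransform.fourier (hg.toLp g) : Lp (α := ℝ) ℂ 2)
  else 0

lemma plancherel_of_memLp {g : ℝ → ℂ} (hg : MemLp g 2 volume) :
    plancherel g = (FourierTransform.fourier (hg.toLp g) : Lp (α := ℝ) ℂ 2) := by
  simp [plancherel, hg]

lemma fourierL2_eq_plancherel (g : ℝ → ℂ) (ξ : ℝ) :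
    fourierL2 g ξ = plancherel g (ξ / (2 * Real.pi)) := by
  unfold fourierL2 plancherel
  split_ifs <;> rfl

lemma memLp_plancherel (g : ℝ → ℂ) : MemLp (plancherel g) 2 volume := by
  by_cases hg : MemLp g 2 (volume : Measure ℝ)
  · rw [plancherel_of_memLp hg]
    exact Lp.memLp _
  · simp [plancherel, hg]

lemma stronglyMeasurable_plancherel (g : ℝ → ℂ) : StronglyMeasurable (plancherel g) := by
  by_cases hg : MemLp g 2 (volume : Measure ℝ)
  · rw [plancherel_of_memLp hg]
    exact Lp.stronglyMeasurable _
  · simp only [plancherel, hg]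
    exact stronglyMeasurable_zero

lemma measurable_plancherel (g : ℝ → ℂ) : Measurable (plancherel g) :=
  (stronglyMeasurable_plancherel g).measurable

lemma plancherel_congr {g g' : ℝ → ℂ} (h : g =ᵐ[volume] g') : plancherel g = plancherel g' := by
  by_cases hg : MemLp g 2 (volume : Measure ℝ)
  · have hg' : MemLp g' 2 (volume : Measure ℝ) := (memLp_congr_ae h).1 hg
    rw [plancherel_of_memLp hg, plancherel_of_memLp hg', (MemLp.toLp_eq_toLp_iff hg hg').2 h]
  · have hg' : ¬ MemLp g' 2 (volume : Measure ℝ) := fun h' => hg ((memLp_congr_ae h).2 h')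
    simp [plancherel, hg, hg']

lemma eLpNorm_plancherel {g : ℝ → ℂ} (hg : MemLp g 2 volume) :
    eLpNorm (plancherel g) 2 volume = eLpNorm g 2 volume := by
  rw [plancherel_of_memLp hg, ← Lp.enorm_def, ← Lp.enorm_toLp hg]
  have := Lp.norm_fourier_eq (hg.toLp g)
  rw [← ofReal_norm, ← ofReal_norm, this]

lemma eLpNorm_two_sq (f : ℝ → ℂ) : eLpNorm f 2 volume ^ 2 = ∫⁻ x, ‖f x‖ₑ ^ 2 := by
  have := eLpNorm_nnreal_pow_eq_lintegral (μ := (volume : Measure ℝ)) (f := f) (p := 2) (by norm_num)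
  norm_num at this
  exact_mod_cast this

lemma lintegral_plancherel {g : ℝ → ℂ} (hg : MemLp g 2 volume) :
    ∫⁻ ξ, ‖plancherel g ξ‖ₑ ^ 2 = ∫⁻ x, ‖g x‖ₑ ^ 2 := by
  rw [← eLpNorm_two_sq, ← eLpNorm_two_sq, eLpNorm_plancherel hg]

lemma memLp_two_iff_lintegral {g : ℝ → ℂ} (hg : AEStronglyMeasurable g volume) :
    MemLp g 2 volume ↔ ∫⁻ x, ‖g x‖ₑ ^ 2 < ⊤ := by
  rw [← eLpNorm_two_sq, MemLp]
  simp [hg]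

lemma plancherel_add {f g : ℝ → ℂ} (hf : MemLp f 2 volume) (hg : MemLp g 2 volume) :
    plancherel (f + g) =ᵐ[volume] plancherel f + plancherel g := by
  rw [plancherel_of_memLp hf, plancherel_of_memLp hg, plancherel_of_memLp (hf.add hg),
    MemLp.toLp_add, FourierTransform.fourier_add]
  exact Lp.coeFn_add _ _

lemma plancherel_const_smul (c : ℂ) {f : ℝ → ℂ} (hf : MemLp f 2 volume) :
    plancherel (c • f) =ᵐ[volume] c • plancherel f := by
  rw [plancherel_of_memLp hf, plancherel_of_memLp (hf.const_smul c), MemLp.toLp_const_smul,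
    FourierTransform.fourier_smul]
  exact Lp.coeFn_smul _ _

lemma plancherel_sub {f g : ℝ → ℂ} (hf : MemLp f 2 volume) (hg : MemLp g 2 volume) :
    plancherel (f - g) =ᵐ[volume] plancherel f - plancherel g := by
  have h : f - g = f + (-1 : ℂ) • g := by ext; simp [sub_eq_add_neg]
  rw [h]
  filter_upwards [plancherel_add hf (hg.const_smul (-1 : ℂ)), plancherel_const_smul (-1) hg]
    with x h1 h2
  simp only [h1, Pi.add_apply, h2, Pi.smul_apply, Pi.sub_apply]
  simp [sub_eq_add_neg]

/-- This duality makes `plancherel` computable: its further identities are checked by moving the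
transform onto a test function. -/
lemma integral_mul_plancherel {g : ℝ → ℂ} (hg : MemLp g 2 volume) (φ : 𝓢(ℝ, ℂ)) :
    ∫ ξ, φ ξ * plancherel g ξ = ∫ x, (𝓕 φ) x * g x := by
  have h := DFunLike.congr_fun (Lp.fourier_toTemperedDistribution_eq (hg.toLp g)) φ
  rw [TemperedDistribution.fourier_apply, Lp.toTemperedDistribution_apply,
    Lp.toTemperedDistribution_apply] at h
  rw [plancherel_of_memLp hg]
  simp only [smul_eq_mul] at h
  rw [← h]
  apply integral_congr_ae
  filter_upwards [hg.coeFn_toLp] with x hx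
  rw [hx]

lemma exists_plancherel_eq {F : ℝ → ℂ} (hF : MemLp F 2 volume) :
    ∃ u : ℝ → ℂ, MemLp u 2 volume ∧ plancherel u =ᵐ[volume] F := by
  let v : Lp (α := ℝ) ℂ 2 := 𝓕⁻ (hF.toLp F)
  refine ⟨v, Lp.memLp v, ?_⟩
  rw [plancherel_of_memLp (Lp.memLp v), Lp.toLp_coeFn, fourier_fourierInv_eq]
  exact hF.coeFn_toLp

/-- A compactly supported smooth complex function as a Schwartz function. -/
lemma exists_schwartz_eq {φ : ℝ → ℂ} (hφ : ContDiff ℝ ∞ φ) (hc : HasCompactSupport φ) :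
    ∃ ψ : 𝓢(ℝ, ℂ), ∀ x, ψ x = φ x := ⟨hc.toSchwartzMap hφ, fun _ => rfl⟩

/-- Compact support of `φ` is offered as a hypothesis so that `φ` times a smooth exponential is
again a Schwartz function, with no growth estimates. -/
lemma ae_eq_of_integral_schwartz {f f' : ℝ → ℂ} (hf : LocallyIntegrable f volume)
    (hf' : LocallyIntegrable f' volume)
    (h : ∀ φ : 𝓢(ℝ, ℂ), HasCompactSupport φ → ∫ x, φ x * f x = ∫ x, φ x * f' x) :
    f =ᵐ[volume] f' := by
  refine ae_eq_of_integral_contDiff_smul_eq hf hf' fun g hg hgc => ?_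
  have hc : HasCompactSupport (Complex.ofRealCLM ∘ g) := hgc.comp_left rfl
  have hs : ContDiff ℝ ∞ (Complex.ofRealCLM ∘ g) := by fun_prop
  have := h (hc.toSchwartzMap hs) hc
  simpa using this

lemma plancherel_eq_fourier {g : ℝ → ℂ} (hg : MemLp g 2 volume) (hi : Integrable g) :
    plancherel g =ᵐ[volume] 𝓕 g := by
  have hcont : Continuous (𝓕 g) :=
    VectorFourier.fourierIntegral_continuous Real.continuous_fourierChar
      (L := innerₗ ℝ) continuous_inner hi
  refine ae_eq_of_integral_schwartz ((memLp_plancherel g).locallyIntegrable (by norm_num))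
    hcont.locallyIntegrable fun φ _ => ?_
  rw [integral_mul_plancherel hg]
  have := VectorFourier.integral_fourierIntegral_smul_eq_flip (L := innerₗ ℝ)
      (μ := (volume : Measure ℝ)) (ν := (volume : Measure ℝ))
      Real.continuous_fourierChar continuous_inner φ.integrable hi
  simp only [flip_innerₗ, smul_eq_mul] at this
  rw [SchwartzMap.fourier_coe]
  exact this

lemma eq_fourierInv_plancherel {g : ℝ → ℂ} (hg : MemLp g 2 volume)
    (hi : Integrable (plancherel g)) : g =ᵐ[volume] 𝓕⁻ (plancherel g) := by
  have hcont : Continuous (𝓕 (plancherel g)) :=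
    VectorFourier.fourierIntegral_continuous Real.continuous_fourierChar
      (L := innerₗ ℝ) continuous_inner hi
  have hcont' : Continuous (𝓕⁻ (plancherel g)) := by
    have : 𝓕⁻ (plancherel g) = fun x => 𝓕 (plancherel g) (-x) := by
      ext x; rw [Real.fourierInv_eq_fourier_neg]
    rw [this]
    exact hcont.comp continuous_neg
  refine ae_eq_of_integral_schwartz (hg.locallyIntegrable (by norm_num))
    hcont'.locallyIntegrable fun φ _ => ?_
  have h1 := integral_mul_plancherel hg (𝓕⁻ φ)
  rw [fourier_fourierInv_eq] at h1
  rw [← h1]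
  rw [SchwartzMap.fourierInv_coe]
  have e1 : ∀ x, 𝓕⁻ (φ : ℝ → ℂ) x = 𝓕 (fun y => φ (-y)) x := fun x => by
    rw [Real.fourierInv_eq_fourier_comp_neg]
  have hneg : Integrable (fun y => φ (-y)) := φ.integrable.comp_neg
  have hflip := VectorFourier.integral_fourierIntegral_smul_eq_flip (L := innerₗ ℝ)
      (μ := (volume : Measure ℝ)) (ν := (volume : Measure ℝ))
      Real.continuous_fourierChar continuous_inner hneg hi
  simp only [flip_innerₗ, smul_eq_mul] at hflip
  have hflip' : ∫ x, 𝓕 (fun y => φ (-y)) x * plancherel g x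
    = ∫ x, φ (-x) * 𝓕 (plancherel g) x := hflip
  simp_rw [e1]
  rw [hflip', ← integral_neg_eq_self]
  simp_rw [neg_neg, Real.fourierInv_eq_fourier_neg]

lemma plancherel_translate {g : ℝ → ℂ} (hg : MemLp g 2 volume) (h : ℝ) :
    plancherel (fun x => g (x + h)) =ᵐ[volume]
      fun ξ => Complex.exp (2 * Real.pi * Complex.I * h * ξ) * plancherel g ξ := by
  have hgt : MemLp (fun x => g (x + h)) 2 volume :=
    hg.comp_measurePreserving (measurePreserving_add_right volume h)
  have hec : Continuous fun ξ : ℝ => Complex.exp (2 * Real.pi * Complex.I * h * ξ) := by fun_prop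
  have hloc : LocallyIntegrable
      (fun ξ : ℝ => Complex.exp (2 * Real.pi * Complex.I * h * ξ) * plancherel g ξ) volume := by
    have h0 := (memLp_plancherel g).locallyIntegrable (by norm_num)
    rw [← locallyIntegrableOn_univ] at h0 ⊢
    exact h0.continuousOn_mul hec.continuousOn isOpen_univ.isLocallyClosed
  refine ae_eq_of_integral_schwartz ((memLp_plancherel _).locallyIntegrable (by norm_num))
    hloc fun φ hφ => ?_
  rw [integral_mul_plancherel hgt]
  -- The modulated test function: its transform is that of `φ` shifted by `h`, so the exponential
  -- moves onto `g` as a translation.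
  obtain ⟨ψ, hψ⟩ := exists_schwartz_eq
    (φ := fun ξ : ℝ => φ ξ * Complex.exp (2 * Real.pi * Complex.I * h * ξ))
    (by
      have h1 : ContDiff ℝ ∞ φ := φ.smooth ⊤
      have h2 : ContDiff ℝ ∞ fun ξ : ℝ => Complex.exp (2 * Real.pi * Complex.I * h * ξ) := by
        have : ContDiff ℝ ∞ fun ξ : ℝ => (ξ : ℂ) := Complex.ofRealCLM.contDiff
        fun_prop
      exact h1.mul h2) hφ.mul_right
  have h1 := integral_mul_plancherel hg ψ
  have h2 : ∀ x, (𝓕 ψ) x = (𝓕 φ) (x - h) := by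
    intro x
    rw [SchwartzMap.fourier_coe, SchwartzMap.fourier_coe, Real.fourier_real_eq_integral_exp_smul,
      Real.fourier_real_eq_integral_exp_smul]
    congr 1
    ext v
    rw [hψ, smul_eq_mul, smul_eq_mul, mul_comm (φ v), ← mul_assoc, ← Complex.exp_add]
    congr 2
    push_cast
    ring
  simp_rw [hψ, h2] at h1
  simp_rw [← mul_assoc (φ _)]
  rw [h1]
  let Φ : 𝓢(ℝ, ℂ) := 𝓕 φ
  refine Eq.trans ?_ (integral_add_right_eq_self (fun x : ℝ => Φ (x - h) * g x) h)
  refine integral_congr_ae (.of_forall fun x => ?_)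
  change Φ x * g (x + h) = Φ (x + h - h) * g (x + h)
  rw [add_sub_cancel_right]

/-! ### Cauchy–Schwarz, scaling and convergence of power integrals. -/

lemma lintegral_mul_sq_le {α : Type*} [MeasurableSpace α] (μ : Measure α) {f g : α → ℝ≥0∞}
    (hf : AEMeasurable f μ) (hg : AEMeasurable g μ) :
    (∫⁻ a, f a * g a ∂μ) ^ 2 ≤ (∫⁻ a, f a ^ 2 ∂μ) * ∫⁻ a, g a ^ 2 ∂μ := by
  have h := ENNReal.lintegral_mul_le_Lp_mul_Lq μ (p := 2) (q := 2)
    (by rw [Real.holderConjugate_iff]; norm_num) hf hg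
  simp only [Pi.mul_apply, ENNReal.rpow_two] at h
  calc _ ≤ ((∫⁻ a, f a ^ 2 ∂μ) ^ (1 / 2 : ℝ) * (∫⁻ a, g a ^ 2 ∂μ) ^ (1 / 2 : ℝ)) ^ 2 := by gcongr
    _ = _ := by
      rw [mul_pow, ← ENNReal.rpow_two, ← ENNReal.rpow_two, ← ENNReal.rpow_mul, ← ENNReal.rpow_mul]
      norm_num

lemma lintegral_Ioi_comp_mul_left {c : ℝ} (hc : 0 < c) (ε : ℝ) (G : ℝ → ℝ≥0∞) :
    ∫⁻ x in Ioi ε, G (c * x) = ENNReal.ofReal c⁻¹ * ∫⁻ u in Ioi (c * ε), G u := by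
  have him : (fun x => c * x) '' Ioi ε = Ioi (c * ε) := image_mul_left_Ioi hc ε
  have h := lintegral_image_eq_lintegral_abs_deriv_mul (s := Ioi ε) (f := fun x => c * x)
    (f' := fun _ => c) measurableSet_Ioi
    (fun x _ => by simpa using ((hasDerivAt_id x).const_mul c).hasDerivWithinAt)
    (fun x _ y _ hxy => mul_left_cancel₀ hc.ne' hxy) G
  rw [him] at h
  rw [h, lintegral_const_mul' _ _ ENNReal.ofReal_ne_top, ← mul_assoc, ← ENNReal.ofReal_mul
    (by positivity), abs_of_pos hc, inv_mul_cancel₀ hc.ne']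
  simp

lemma lintegral_Ioi_comp_mul_rpow' {c ε : ℝ} (hc : 0 < c) (hε : 0 ≤ ε) (q : ℝ) (φ : ℝ → ℝ≥0∞) :
    ∫⁻ x in Ioi ε, φ (c * x) * ENNReal.ofReal (x ^ (-q)) =
      ENNReal.ofReal (c ^ (q - 1)) * ∫⁻ u in Ioi (c * ε), φ u * ENNReal.ofReal (u ^ (-q)) := by
  have h := lintegral_Ioi_comp_mul_left hc ε (fun u => φ u * ENNReal.ofReal (u ^ (-q)))
  have h2 : ∫⁻ x in Ioi ε, φ (c * x) * ENNReal.ofReal (x ^ (-q)) =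
      ENNReal.ofReal (c ^ q) * ∫⁻ x in Ioi ε, φ (c * x) * ENNReal.ofReal ((c * x) ^ (-q)) := by
    rw [← lintegral_const_mul' _ _ ENNReal.ofReal_ne_top]
    refine setLIntegral_congr_fun measurableSet_Ioi fun x hx => ?_
    have hx' : 0 < x := hε.trans_lt hx
    rw [mul_left_comm, ← ENNReal.ofReal_mul (by positivity), Real.mul_rpow hc.le hx'.le,
      ← mul_assoc, ← Real.rpow_add hc]
    simp
  rw [h2, h, ← mul_assoc, ← ENNReal.ofReal_mul (by positivity), Real.rpow_sub hc, Real.rpow_one]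
  rfl

lemma lintegral_Ioi_comp_mul_rpow {c : ℝ} (hc : 0 < c) (q : ℝ) (φ : ℝ → ℝ≥0∞) :
    ∫⁻ x in Ioi 0, φ (c * x) * ENNReal.ofReal (x ^ (-q)) =
      ENNReal.ofReal (c ^ (q - 1)) * ∫⁻ u in Ioi 0, φ u * ENNReal.ofReal (u ^ (-q)) := by
  simpa using lintegral_Ioi_comp_mul_rpow' hc le_rfl q φ

lemma lintegral_Ioc_rpow_lt_top {r b : ℝ} (hr : -1 < r) (hb : 0 < b) :
    ∫⁻ u in Ioc 0 b, ENNReal.ofReal (u ^ r) < ⊤ := by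
  have h := ((intervalIntegral.integrableOn_Ioo_rpow_iff hb).2 hr)
  rw [← integrableOn_Ioc_iff_integrableOn_Ioo] at h
  exact h.lintegral_lt_top

lemma lintegral_Ioi_rpow_lt_top {r b : ℝ} (hr : r < -1) (hb : 0 < b) :
    ∫⁻ u in Ioi b, ENNReal.ofReal (u ^ r) < ⊤ :=
  (integrableOn_Ioi_rpow_of_lt hr hb).lintegral_lt_top

lemma lintegral_Ioi_rpow {q b : ℝ} (hq : 0 < q) (hb : 0 < b) :
    ∫⁻ u in Ioi b, ENNReal.ofReal (u ^ (-(1 + q))) = ENNReal.ofReal (b ^ (-q) / q) := by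
  rw [← ofReal_integral_eq_lintegral_ofReal
    (integrableOn_Ioi_rpow_of_lt (by linarith) hb)
    (by
      filter_upwards [ae_restrict_mem measurableSet_Ioi] with x hx
      exact Real.rpow_nonneg (hb.le.trans (le_of_lt hx)) _),
    integral_Ioi_rpow_of_lt (by linarith) hb]
  congr 1
  have : -(1 + q) + 1 = -q := by ring
  rw [this, neg_div_neg_eq]

/-- An integral of a power times a function that grows at most like `u ^ a` near the origin and is
bounded at infinity. -/
lemma lintegral_mul_rpow_lt_top {φ : ℝ → ℝ} {A B a q : ℝ} (hA : 0 ≤ A)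
    (h0 : ∀ u ∈ Ioc (0 : ℝ) 1, φ u ≤ A * u ^ a) (h1 : ∀ u ∈ Ioi (1 : ℝ), φ u ≤ B)
    (hq1 : 1 < q) (hq2 : q < a + 1) :
    ∫⁻ u in Ioi 0, ENNReal.ofReal (φ u) * ENNReal.ofReal (u ^ (-q)) < ⊤ := by
  rw [← Ioc_union_Ioi_eq_Ioi (zero_le_one' ℝ)]
  refine (lintegral_union_le _ _ _).trans_lt (ENNReal.add_lt_top.2 ⟨?_, ?_⟩)
  · calc _ ≤ ∫⁻ u in Ioc (0 : ℝ) 1, ENNReal.ofReal A * ENNReal.ofReal (u ^ (a - q)) := by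
          refine setLIntegral_mono' measurableSet_Ioc fun u hu => ?_
          have hu0 : 0 < u := hu.1
          rw [sub_eq_add_neg, Real.rpow_add hu0, ENNReal.ofReal_mul (by positivity), ← mul_assoc,
            ← ENNReal.ofReal_mul hA]
          gcongr
          exact h0 u hu
      _ < ⊤ := by
        rw [lintegral_const_mul' _ _ ENNReal.ofReal_ne_top]
        exact ENNReal.mul_lt_top ENNReal.ofReal_lt_top
          (lintegral_Ioc_rpow_lt_top (by linarith) one_pos)
  · calc _ ≤ ∫⁻ u in Ioi (1 : ℝ), ENNReal.ofReal B * ENNReal.ofReal (u ^ (-q)) := by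
          refine setLIntegral_mono' measurableSet_Ioi fun u hu => ?_
          gcongr
          exact h1 u hu
      _ < ⊤ := by
        rw [lintegral_const_mul' _ _ ENNReal.ofReal_ne_top]
        exact ENNReal.mul_lt_top ENNReal.ofReal_lt_top
          (lintegral_Ioi_rpow_lt_top (by linarith) one_pos)

/-! ### Second differences and the homogeneous Sobolev seminorm. -/

/-- The symmetric second difference of `g` with step `h`. -/
def secondDiff (h : ℝ) (g : ℝ → ℂ) (x : ℝ) : ℂ := g (x + h) - 2 * g x + g (x - h)

/-- The homogeneous Sobolev energy of order `σ`, expressed through second differences. -/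
def diffEnergy (σ : ℝ) (g : ℝ → ℂ) : ℝ≥0∞ :=
  ∫⁻ h in Ioi 0, (∫⁻ x, ‖secondDiff h g x‖ₑ ^ 2) * ENNReal.ofReal (h ^ (-(1 + 2 * σ)))

/-- The constant relating `diffEnergy` to the Fourier transform. -/
def diffEnergyConst (σ : ℝ) : ℝ≥0∞ :=
  ∫⁻ u in Ioi 0, ENNReal.ofReal ((2 - 2 * Real.cos (2 * Real.pi * u)) ^ 2) *
    ENNReal.ofReal (u ^ (-(1 + 2 * σ)))

/-- Since `2 - 2 cos(2πu) ≤ 4π²u²`, the integrand is `O(u^{4-1-2σ})` at the origin, which needs `σ <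
2`; at infinity it is `O(u^{-1-2σ})`, which needs `σ > 0`. -/
lemma diffEnergyConst_lt_top {σ : ℝ} (h0 : 0 < σ) (h2 : σ < 2) : diffEnergyConst σ < ⊤ := by
  refine lintegral_mul_rpow_lt_top (A := (4 * Real.pi ^ 2) ^ 2) (B := 16) (a := 4)
    (by positivity) (fun u hu => ?_) (fun u _ => ?_) (by linarith) (by linarith)
  · have h1 := Real.one_sub_sq_div_two_le_cos (x := 2 * Real.pi * u)
    have h3 := Real.cos_le_one (2 * Real.pi * u)
    have : (u : ℝ) ^ (4 : ℝ) = (u ^ 2) ^ 2 := by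
      rw [← pow_mul]; exact_mod_cast Real.rpow_natCast u 4
    rw [this, ← mul_pow]
    refine pow_le_pow_left₀ (by linarith) ?_ 2
    nlinarith
  · have h3 := Real.cos_le_one (2 * Real.pi * u)
    have h4 := Real.neg_one_le_cos (2 * Real.pi * u)
    nlinarith

lemma diffEnergyConst_ne_zero (σ : ℝ) : diffEnergyConst σ ≠ 0 := by
  unfold diffEnergyConst
  rw [← pos_iff_ne_zero, setLIntegral_pos_iff (by fun_prop)]
  refine lt_of_lt_of_le (by simp : (0 : ℝ≥0∞) < volume (Ioo (0 : ℝ) (1 / 2)))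
    (measure_mono fun u hu => ⟨?_, hu.1⟩)
  have hu0 : 0 < u := hu.1
  have hlt : Real.cos (2 * Real.pi * u) < 1 := by
    rw [← Real.cos_zero]
    refine Real.cos_lt_cos_of_nonneg_of_le_pi le_rfl ?_ (by positivity)
    nlinarith [hu.2, Real.pi_pos]
  have h1 : 0 < (2 - 2 * Real.cos (2 * Real.pi * u)) ^ 2 := by
    have : 0 < 2 - 2 * Real.cos (2 * Real.pi * u) := by linarith
    positivity
  have h2 : 0 < u ^ (-(1 + 2 * σ)) := by positivity
  simp only [Function.mem_support, ne_eq, mul_eq_zero, ENNReal.ofReal_eq_zero, not_or, not_le]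
  exact ⟨h1, h2⟩

lemma memLp_comp_add {g : ℝ → ℂ} (hg : MemLp g 2 volume) (h : ℝ) :
    MemLp (fun x => g (x + h)) 2 volume :=
  hg.comp_measurePreserving (measurePreserving_add_right volume h)

lemma memLp_secondDiff {g : ℝ → ℂ} (hg : MemLp g 2 volume) (h : ℝ) :
    MemLp (secondDiff h g) 2 volume := by
  have h1 := ((memLp_comp_add hg h).sub (hg.const_smul (2 : ℂ))).add (memLp_comp_add hg (-h))
  exact h1

lemma plancherel_secondDiff {g : ℝ → ℂ} (hg : MemLp g 2 volume) (h : ℝ) :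
    plancherel (secondDiff h g) =ᵐ[volume]
      fun ξ => ((2 * Real.cos (2 * Real.pi * (h * ξ)) - 2 : ℝ) : ℂ) * plancherel g ξ := by
  have e : secondDiff h g =
      ((fun x => g (x + h)) - (2 : ℂ) • g) + fun x => g (x + -h) := by
    ext x; simp [secondDiff, sub_eq_add_neg]
  rw [e]
  filter_upwards [plancherel_add ((memLp_comp_add hg h).sub (hg.const_smul (2 : ℂ)))
    (memLp_comp_add hg (-h)), plancherel_sub (memLp_comp_add hg h) (hg.const_smul (2 : ℂ)),
    plancherel_const_smul 2 hg, plancherel_translate hg h, plancherel_translate hg (-h)]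
    with ξ h1 h2 h3 h4 h5
  rw [h1, Pi.add_apply, h2, Pi.sub_apply, h3, h4, h5]
  simp only [Pi.smul_apply, smul_eq_mul]
  push_cast
  rw [Complex.cos]
  have e1 : (2 * Real.pi * Complex.I * h * ξ : ℂ) = 2 * Real.pi * (h * ξ) * Complex.I := by ring
  have e2 : (2 * Real.pi * Complex.I * (-h) * ξ : ℂ) = -(2 * Real.pi * (h * ξ)) * Complex.I := by
    ring
  rw [e1, e2]
  ring

lemma lintegral_secondDiff {g : ℝ → ℂ} (hg : MemLp g 2 volume) (h : ℝ) :
    ∫⁻ x, ‖secondDiff h g x‖ₑ ^ 2 =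
      ∫⁻ ξ, ENNReal.ofReal ((2 - 2 * Real.cos (2 * Real.pi * (|ξ| * h))) ^ 2) *
        ‖plancherel g ξ‖ₑ ^ 2 := by
  rw [← lintegral_plancherel (memLp_secondDiff hg h)]
  refine lintegral_congr_ae ?_
  filter_upwards [plancherel_secondDiff hg h] with ξ hξ
  have hc : Real.cos (2 * Real.pi * (|ξ| * h)) = Real.cos (2 * Real.pi * (h * ξ)) := by
    rcases abs_cases ξ with ⟨e, _⟩ | ⟨e, _⟩
    · rw [e, mul_comm ξ]
    · rw [e, ← Real.cos_neg]; congr 1; ring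
  rw [hξ, enorm_mul, mul_pow, hc]
  congr 1
  rw [← ofReal_norm, Complex.norm_real, ← ENNReal.ofReal_pow (norm_nonneg _), Real.norm_eq_abs,
    sq_abs]
  congr 1
  ring

/-- Plancherel in `x`, Tonelli, then the scaling `u = |ξ|h` in the step integral, which extracts
`|ξ|^{2σ}`. -/
lemma diffEnergy_eq {σ : ℝ} (hσ : 0 < σ) {g : ℝ → ℂ} (hg : MemLp g 2 volume) :
    diffEnergy σ g =
      diffEnergyConst σ * ∫⁻ ξ, ENNReal.ofReal (|ξ| ^ (2 * σ)) * ‖plancherel g ξ‖ₑ ^ 2 := by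
  have hm := measurable_plancherel g
  have hmeas : Measurable (Function.uncurry fun h ξ : ℝ =>
      ENNReal.ofReal ((2 - 2 * Real.cos (2 * Real.pi * (|ξ| * h))) ^ 2) *
        ‖plancherel g ξ‖ₑ ^ 2 * ENNReal.ofReal (h ^ (-(1 + 2 * σ)))) := by
    unfold Function.uncurry
    fun_prop
  calc diffEnergy σ g
      = ∫⁻ h in Ioi 0, ∫⁻ ξ, ENNReal.ofReal ((2 - 2 * Real.cos (2 * Real.pi * (|ξ| * h))) ^ 2) *
        ‖plancherel g ξ‖ₑ ^ 2 * ENNReal.ofReal (h ^ (-(1 + 2 * σ))) := by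
        refine lintegral_congr fun h => ?_
        rw [lintegral_secondDiff hg, lintegral_mul_const' _ _ ENNReal.ofReal_ne_top]
    _ = ∫⁻ ξ, ∫⁻ h in Ioi 0, ENNReal.ofReal ((2 - 2 * Real.cos (2 * Real.pi * (|ξ| * h))) ^ 2) *
        ‖plancherel g ξ‖ₑ ^ 2 * ENNReal.ofReal (h ^ (-(1 + 2 * σ))) :=
        lintegral_lintegral_swap hmeas.aemeasurable
    _ = ∫⁻ ξ, diffEnergyConst σ *
          (ENNReal.ofReal (|ξ| ^ (2 * σ)) * ‖plancherel g ξ‖ₑ ^ 2) := by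
        refine lintegral_congr fun ξ => ?_
        have e : ∀ h : ℝ, ENNReal.ofReal ((2 - 2 * Real.cos (2 * Real.pi * (|ξ| * h))) ^ 2) *
            ‖plancherel g ξ‖ₑ ^ 2 * ENNReal.ofReal (h ^ (-(1 + 2 * σ))) =
            ‖plancherel g ξ‖ₑ ^ 2 *
              (ENNReal.ofReal ((2 - 2 * Real.cos (2 * Real.pi * (|ξ| * h))) ^ 2) *
              ENNReal.ofReal (h ^ (-(1 + 2 * σ)))) := fun h => by ring
        simp_rw [e]
        rw [lintegral_const_mul' _ _ (by finiteness)]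
        -- Scaling needs `|ξ| > 0`; at `ξ = 0` both sides vanish, the right one because `2σ ≠ 0`.
        rcases eq_or_ne ξ 0 with rfl | hξ
        · simp [Real.zero_rpow (by positivity : 2 * σ ≠ 0)]
        · rw [lintegral_Ioi_comp_mul_rpow (abs_pos.2 hξ) (1 + 2 * σ)
            (fun u => ENNReal.ofReal ((2 - 2 * Real.cos (2 * Real.pi * u)) ^ 2))]
          rw [add_sub_cancel_left, ← diffEnergyConst]
          ring
    _ = _ := lintegral_const_mul _ (by fun_prop)

/-! ### Hardy's inequality for `σ < 1/2`. -/

/-- The weighted integral on the left of Hardy's inequality. -/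
def hardyIntegral (σ : ℝ) (g : ℝ → ℂ) : ℝ≥0∞ :=
  ∫⁻ x in Ioi 0, ‖g x‖ₑ ^ 2 * ENNReal.ofReal (x ^ (-(2 * σ)))

lemma enorm_sub_add_sq_le (a b c : ℂ) :
    ‖a - 2 * b + c‖ₑ ^ 2 ≤ 3 * ‖a‖ₑ ^ 2 + 12 * ‖b‖ₑ ^ 2 + 3 * ‖c‖ₑ ^ 2 := by
  have h1 : ‖a - 2 * b + c‖ ≤ ‖a‖ + 2 * ‖b‖ + ‖c‖ := by
    refine (norm_add_le _ _).trans ?_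
    gcongr
    refine (norm_sub_le _ _).trans ?_
    simp
  have h2 : ‖a - 2 * b + c‖ ^ 2 ≤ 3 * ‖a‖ ^ 2 + 12 * ‖b‖ ^ 2 + 3 * ‖c‖ ^ 2 := by
    refine (pow_le_pow_left₀ (norm_nonneg _) h1 2).trans ?_
    nlinarith [sq_nonneg (‖a‖ - 2 * ‖b‖), sq_nonneg (‖a‖ - ‖c‖), sq_nonneg (‖c‖ - 2 * ‖b‖)]
  have h3 := ENNReal.ofReal_le_ofReal h2
  rw [ENNReal.ofReal_add (by positivity) (by positivity),
    ENNReal.ofReal_add (by positivity) (by positivity), ENNReal.ofReal_mul (by norm_num),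
    ENNReal.ofReal_mul (by norm_num), ENNReal.ofReal_mul (by norm_num)] at h3
  simpa [ENNReal.ofReal_pow, ofReal_norm] using h3

/-- Centring the difference at `x + h` solves for `g x` using only points to its right. With `h`
proportional to `x` these points are dilates of `x`. -/
lemma enorm_sq_le_secondDiff (g : ℝ → ℂ) (x h : ℝ) :
    ‖g x‖ₑ ^ 2 ≤ 3 * ‖secondDiff h g (x + h)‖ₑ ^ 2 + 12 * ‖g (x + h)‖ₑ ^ 2 +
      3 * ‖g (x + 2 * h)‖ₑ ^ 2 := by
  have h1 := enorm_sub_add_sq_le (secondDiff h g (x + h)) (-g (x + h)) (-g (x + 2 * h))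
  rw [enorm_neg, enorm_neg] at h1
  convert h1 using 3
  simp only [secondDiff, add_sub_cancel_right]
  rw [show x + h + h = x + 2 * h by ring]
  ring

/-- As `c ≥ 1`, dilation preserves the truncation to `(ε,∞)`. For `σ < 1/2` the factor `c^{2σ-1}` is
small for large `c`, which allows absorption. -/
lemma lintegral_Ioi_dilate_le {g : ℝ → ℂ} {σ c ε : ℝ} (hc : 1 ≤ c) (hε : 0 < ε) :
    ∫⁻ x in Ioi ε, ‖g (c * x)‖ₑ ^ 2 * ENNReal.ofReal (x ^ (-(2 * σ))) ≤
      ENNReal.ofReal (c ^ (2 * σ - 1)) *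
        ∫⁻ x in Ioi ε, ‖g x‖ₑ ^ 2 * ENNReal.ofReal (x ^ (-(2 * σ))) := by
  rw [lintegral_Ioi_comp_mul_rpow' (by linarith) hε.le (2 * σ) (fun u => ‖g u‖ₑ ^ 2)]
  gcongr
  nlinarith

lemma measurable_secondDiff_uncurry {g : ℝ → ℂ} (hgm : Measurable g) {a b : ℝ × ℝ → ℝ}
    (ha : Measurable a) (hb : Measurable b) :
    Measurable fun z => secondDiff (a z) g (b z) := by
  unfold secondDiff
  fun_prop

lemma lintegral_three_add {α : Type*} [MeasurableSpace α] {μ : Measure α} {a b c w : α → ℝ≥0∞}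
    (ha : Measurable a) (hb : Measurable b) (hc : Measurable c) (hw : Measurable w) :
    ∫⁻ x, (3 * a x + 12 * b x + 3 * c x) * w x ∂μ =
      3 * ∫⁻ x, a x * w x ∂μ + 12 * ∫⁻ x, b x * w x ∂μ + 3 * ∫⁻ x, c x * w x ∂μ := by
  simp_rw [add_mul, mul_assoc]
  rw [lintegral_add_left (by fun_prop), lintegral_add_left (by fun_prop),
    lintegral_const_mul _ (by fun_prop), lintegral_const_mul _ (by fun_prop),
    lintegral_const_mul _ (by fun_prop)]

/-- The absorption step of Hardy's inequality at low regularity: a truncated Hardy integral is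
controlled by second differences with steps proportional to the distance from the origin. -/
lemma truncated_hardy_le {σ L l ε : ℝ} (hσ : σ < 1 / 2) (hL : 0 < L)
    (hL' : 15 * (1 + L) ^ (2 * σ - 1) ≤ 1 / 2) (hl : L ≤ l) (hε : 0 < ε)
    {g : ℝ → ℂ} (hgm : Measurable g)
    (hA : ∫⁻ x in Ioi ε, ‖g x‖ₑ ^ 2 * ENNReal.ofReal (x ^ (-(2 * σ))) ≠ ⊤) :
    ∫⁻ x in Ioi ε, ‖g x‖ₑ ^ 2 * ENNReal.ofReal (x ^ (-(2 * σ))) ≤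
      6 * ∫⁻ x in Ioi 0, ‖secondDiff (l * x) g (x + l * x)‖ₑ ^ 2 *
        ENNReal.ofReal (x ^ (-(2 * σ))) := by
  set A := ∫⁻ x in Ioi ε, ‖g x‖ₑ ^ 2 * ENNReal.ofReal (x ^ (-(2 * σ)))
  set T := ∫⁻ x in Ioi 0, ‖secondDiff (l * x) g (x + l * x)‖ₑ ^ 2 *
        ENNReal.ofReal (x ^ (-(2 * σ)))
  have hsd : Measurable fun x => secondDiff (l * x) g (x + l * x) := by
    unfold secondDiff; fun_prop
  -- Both dilation factors `1 + l` and `1 + 2l` are at least `1 + L`; their weights `12` and `3` add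
  -- up to the `15` in `hL'`.
  have key : A ≤ 3 * T + ENNReal.ofReal (1 / 2) * A := by
    have hdil : ∀ c : ℝ, 1 + L ≤ c →
        ∫⁻ x in Ioi ε, ‖g (c * x)‖ₑ ^ 2 * ENNReal.ofReal (x ^ (-(2 * σ))) ≤
          ENNReal.ofReal ((1 + L) ^ (2 * σ - 1)) * A := fun c hc =>
      (lintegral_Ioi_dilate_le (by linarith) hε).trans
        (mul_le_mul_left (ENNReal.ofReal_le_ofReal
          (Real.rpow_le_rpow_of_nonpos (by linarith) hc (by linarith))) _)
    have hsplit := lintegral_three_add (μ := volume.restrict (Ioi ε))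
      (a := fun x => ‖secondDiff (l * x) g (x + l * x)‖ₑ ^ 2)
      (b := fun x => ‖g ((1 + l) * x)‖ₑ ^ 2) (c := fun x => ‖g ((1 + 2 * l) * x)‖ₑ ^ 2)
      (w := fun x => ENNReal.ofReal (x ^ (-(2 * σ))))
      (by fun_prop) (by fun_prop) (by fun_prop) (by fun_prop)
    calc A ≤ _ := by
          refine lintegral_mono fun x => mul_le_mul_left ?_ (ENNReal.ofReal (x ^ (-(2 * σ))))
          have := enorm_sq_le_secondDiff g x (l * x)
          rwa [show x + 2 * (l * x) = (1 + 2 * l) * x by ring,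
            show g (x + l * x) = g ((1 + l) * x) by ring_nf] at this
      _ = _ := hsplit
      _ ≤ 3 * T + 12 * (ENNReal.ofReal ((1 + L) ^ (2 * σ - 1)) * A) +
          3 * (ENNReal.ofReal ((1 + L) ^ (2 * σ - 1)) * A) := by
          refine add_le_add (add_le_add (mul_le_mul_right (lintegral_mono_set
            (Ioi_subset_Ioi hε.le)) _) (mul_le_mul_right (hdil _ (by linarith)) _))
            (mul_le_mul_right (hdil _ (by linarith)) _)
      _ = 3 * T + ENNReal.ofReal (15 * (1 + L) ^ (2 * σ - 1)) * A := by
          rw [ENNReal.ofReal_mul (by norm_num)]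
          simp only [ENNReal.ofReal_ofNat]
          ring
      _ ≤ _ := add_le_add le_rfl (mul_le_mul_left (ENNReal.ofReal_le_ofReal hL') _)
  rcases eq_or_ne T ⊤ with hT | hT
  · rw [hT]; simp
  -- Finiteness of `A` is what permits subtracting `A / 2` from both sides.
  have hA2 := ENNReal.toReal_mono (by finiteness) key
  rw [ENNReal.toReal_add (by finiteness) (by finiteness), ENNReal.toReal_mul,
    ENNReal.toReal_mul, ENNReal.toReal_ofReal (by norm_num)] at hA2
  rw [← ENNReal.toReal_le_toReal hA (by finiteness), ENNReal.toReal_mul]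
  norm_num at hA2 ⊢
  linarith

lemma hardyIntegral_le_of_lt_half {σ : ℝ} (h0 : 0 < σ) (h2 : σ < 1 / 2) :
    ∃ C : ℝ≥0, ∀ g : ℝ → ℂ, Measurable g → MemLp g 2 volume →
      hardyIntegral σ g ≤ C * diffEnergy σ g := by
  obtain ⟨L, hL, hL'⟩ : ∃ L : ℝ, 0 < L ∧ 15 * (1 + L) ^ (2 * σ - 1) ≤ 1 / 2 := by
    have ht : Tendsto (fun L : ℝ => 15 * (1 + L) ^ (2 * σ - 1)) atTop (𝓝 (15 * 0)) := by
      refine Tendsto.const_mul _ ?_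
      have h := tendsto_rpow_neg_atTop (y := 1 - 2 * σ) (by linarith)
      have h' := h.comp (tendsto_atTop_add_const_left atTop (1 : ℝ) tendsto_id)
      refine h'.congr fun x => ?_
      simp
    rw [mul_zero] at ht
    have hev := (ht.eventually (ge_mem_nhds (by norm_num : (0 : ℝ) < 1 / 2))).and
      (eventually_gt_atTop 0)
    obtain ⟨L, hL⟩ := hev.exists
    exact ⟨L, hL.2, hL.1⟩
  -- Chosen so that `K * l ^ (-(1 + 2σ)) ≥ 1` for `0 < l ≤ 2L`: the step weight can be inserted at
  -- the cost of `K`.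
  let K : ℝ := (2 * L) ^ (1 + 2 * σ)
  refine ⟨Real.toNNReal (L⁻¹ * 6 * K), fun g hgm hg => ?_⟩
  have hfin : ∫⁻ x, ‖g x‖ₑ ^ 2 < ⊤ := (memLp_two_iff_lintegral hg.1).1 hg
  have main : ∀ ε : ℝ, 0 < ε →
      ∫⁻ x in Ioi ε, ‖g x‖ₑ ^ 2 * ENNReal.ofReal (x ^ (-(2 * σ))) ≤
        Real.toNNReal (L⁻¹ * 6 * K) * diffEnergy σ g := by
    intro ε hε
    set A := ∫⁻ x in Ioi ε, ‖g x‖ₑ ^ 2 * ENNReal.ofReal (x ^ (-(2 * σ)))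
    -- Away from the origin the weight is at most `ε^{-2σ}`, so the `L²` norm bounds the truncated
    -- integral.
    have hA : A ≠ ⊤ := by
      refine ne_top_of_le_ne_top (b := (∫⁻ x, ‖g x‖ₑ ^ 2) * ENNReal.ofReal (ε ^ (-(2 * σ))))
        (by finiteness) ?_
      rw [← lintegral_mul_const' _ _ ENNReal.ofReal_ne_top]
      refine (setLIntegral_mono' measurableSet_Ioi fun x hx => ?_).trans
        (setLIntegral_le_lintegral _ _)
      exact mul_le_mul_right (ENNReal.ofReal_le_ofReal
        (Real.rpow_le_rpow_of_nonpos hε (le_of_lt hx) (by linarith))) _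
    have hm1 : Measurable fun z : ℝ × ℝ => secondDiff (z.1 * z.2) g (z.2 + z.1 * z.2) :=
      measurable_secondDiff_uncurry hgm (by fun_prop) (by fun_prop)
    have hm2 : Measurable fun z : ℝ × ℝ => secondDiff z.2 g (z.1 + z.2) :=
      measurable_secondDiff_uncurry hgm (by fun_prop) (by fun_prop)
    -- A single `l` sees only the steps `h = lx`. Averaging over `L < l ≤ 2L` and substituting `h =
    -- lx` for fixed `x` produces the full double integral of `diffEnergy`.
    have step : ENNReal.ofReal L * A ≤ 6 * (ENNReal.ofReal K * diffEnergy σ g) := by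
      calc ENNReal.ofReal L * A = ∫⁻ l in Ioc L (2 * L), A := by
            rw [setLIntegral_const, Real.volume_Ioc, mul_comm]
            congr 2; ring
        _ ≤ ∫⁻ l in Ioc L (2 * L), 6 * ∫⁻ x in Ioi 0,
              ‖secondDiff (l * x) g (x + l * x)‖ₑ ^ 2 * ENNReal.ofReal (x ^ (-(2 * σ))) :=
            setLIntegral_mono' measurableSet_Ioc fun l hl =>
              truncated_hardy_le h2 hL hL' hl.1.le hε hgm hA
        _ = 6 * ∫⁻ l in Ioc L (2 * L), ∫⁻ x in Ioi 0,
              ‖secondDiff (l * x) g (x + l * x)‖ₑ ^ 2 * ENNReal.ofReal (x ^ (-(2 * σ))) :=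
            lintegral_const_mul' _ _ (by norm_num)
        _ = 6 * ∫⁻ x in Ioi 0, ∫⁻ l in Ioc L (2 * L),
              ‖secondDiff (l * x) g (x + l * x)‖ₑ ^ 2 * ENNReal.ofReal (x ^ (-(2 * σ))) := by
            rw [lintegral_lintegral_swap]
            refine Measurable.aemeasurable ?_
            unfold Function.uncurry
            fun_prop
        _ ≤ 6 * ∫⁻ x in Ioi 0, ENNReal.ofReal K * ∫⁻ h in Ioi 0,
              ‖secondDiff h g (x + h)‖ₑ ^ 2 * ENNReal.ofReal (h ^ (-(1 + 2 * σ))) := by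
            refine mul_le_mul_right (setLIntegral_mono' measurableSet_Ioi fun x hx => ?_) _
            have hx0 : 0 < x := hx
            rw [lintegral_mul_const' _ _ ENNReal.ofReal_ne_top]
            have e1 : ∫⁻ l in Ioc L (2 * L), ‖secondDiff (l * x) g (x + l * x)‖ₑ ^ 2 ≤
                ENNReal.ofReal K * ∫⁻ l in Ioi 0, ‖secondDiff (x * l) g (x + x * l)‖ₑ ^ 2 *
                  ENNReal.ofReal (l ^ (-(1 + 2 * σ))) := by
              rw [← lintegral_const_mul' _ _ ENNReal.ofReal_ne_top]
              refine (setLIntegral_mono' measurableSet_Ioc fun l hl => ?_).trans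
                (lintegral_mono_set (Ioc_subset_Ioi_self.trans (Ioi_subset_Ioi hL.le)))
              have hl0 : 0 < l := hL.trans hl.1
              have hone : (1 : ℝ≥0∞) ≤ ENNReal.ofReal (K * l ^ (-(1 + 2 * σ))) := by
                rw [ENNReal.one_le_ofReal, Real.rpow_neg hl0.le, ← div_eq_mul_inv,
                  one_le_div (by positivity)]
                exact Real.rpow_le_rpow hl0.le hl.2 (by linarith)
              rw [ENNReal.ofReal_mul (by positivity)] at hone
              rw [mul_comm l x, mul_left_comm]
              exact le_mul_of_one_le_right' hone
            rw [lintegral_Ioi_comp_mul_rpow hx0 (1 + 2 * σ)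
              (fun h => ‖secondDiff h g (x + h)‖ₑ ^ 2), add_sub_cancel_left] at e1
            refine (mul_le_mul_left e1 _).trans (le_of_eq ?_)
            rw [mul_assoc, mul_right_comm, ← ENNReal.ofReal_mul (by positivity),
              ← Real.rpow_add hx0]
            simp
        _ ≤ 6 * ∫⁻ x, ENNReal.ofReal K * ∫⁻ h in Ioi 0,
              ‖secondDiff h g (x + h)‖ₑ ^ 2 * ENNReal.ofReal (h ^ (-(1 + 2 * σ))) := by
            gcongr
            exact Measure.restrict_le_self
        _ = 6 * (ENNReal.ofReal K * ∫⁻ x, ∫⁻ h in Ioi 0,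
              ‖secondDiff h g (x + h)‖ₑ ^ 2 * ENNReal.ofReal (h ^ (-(1 + 2 * σ)))) := by
            rw [lintegral_const_mul' _ _ ENNReal.ofReal_ne_top]
        _ = _ := by
            rw [lintegral_lintegral_swap]
            · unfold diffEnergy
              congr 2
              refine lintegral_congr fun h => ?_
              rw [lintegral_mul_const' _ _ ENNReal.ofReal_ne_top]
              congr 1
              exact lintegral_add_right_eq_self (fun x => ‖secondDiff h g x‖ₑ ^ 2) h
            · refine Measurable.aemeasurable ?_
              unfold Function.uncurry
              fun_prop
    have hL2 : ENNReal.ofReal L⁻¹ * ENNReal.ofReal L = 1 := by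
      rw [← ENNReal.ofReal_mul (by positivity), inv_mul_cancel₀ hL.ne', ENNReal.ofReal_one]
    calc A = ENNReal.ofReal L⁻¹ * (ENNReal.ofReal L * A) := by rw [← mul_assoc, hL2, one_mul]
      _ ≤ ENNReal.ofReal L⁻¹ * (6 * (ENNReal.ofReal K * diffEnergy σ g)) := by gcongr
      _ = _ := by
        change _ = ENNReal.ofReal _ * _
        rw [ENNReal.ofReal_mul (by positivity), ENNReal.ofReal_mul (by positivity)]
        simp only [ENNReal.ofReal_ofNat]
        ring
  -- The bound does not depend on `ε`, so monotone convergence removes the truncation.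
  have hU : Ioi (0 : ℝ) = ⋃ n : ℕ, Ioi (1 / ((n : ℝ) + 1)) := by
    ext x
    simp only [mem_Ioi, mem_iUnion]
    exact ⟨fun hx => exists_nat_one_div_lt hx, fun ⟨n, hn⟩ => lt_trans (by positivity) hn⟩
  unfold hardyIntegral
  rw [hU, setLIntegral_iUnion_of_directed]
  · exact iSup_le fun n => main _ (by positivity)
  · refine Monotone.directed_le fun m n hmn => Ioi_subset_Ioi ?_
    have : (m : ℝ) ≤ n := by exact_mod_cast hmn
    gcongr

/-! ### Hardy's inequality for `1/2 < σ < 3/2`. -/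

lemma lintegral_comp_abs (f : ℝ → ℝ≥0∞) : ∫⁻ x, f |x| = 2 * ∫⁻ x in Ioi 0, f x := by
  have h1 : ∫⁻ x in Ioi (0 : ℝ), f |x| = ∫⁻ x in Ioi 0, f x :=
    setLIntegral_congr_fun measurableSet_Ioi fun x hx => by rw [abs_of_pos hx]
  have h2 : ∫⁻ x in Iic (0 : ℝ), f |x| = ∫⁻ x in Ioi (0 : ℝ), f |x| := by
    rw [← restrict_Iio_eq_restrict_Iic, ← (Measure.measurePreserving_neg
      (volume : Measure ℝ)).setLIntegral_comp_preimage_emb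
      (Homeomorph.neg ℝ).measurableEmbedding (fun x => f |x|)]
    simp
  rw [← lintegral_add_compl _ (measurableSet_Iic : MeasurableSet (Iic (0 : ℝ))), compl_Iic, h2, h1,
    two_mul]

/-- A bound for `|e^{2πiu} - 1|`, `u ≥ 0`. -/
def oscBound (u : ℝ) : ℝ := min 2 (2 * Real.pi * u)

lemma measurable_oscBound : Measurable oscBound := by
  unfold oscBound; fun_prop

/-- Hardy's inequality at high regularity on the Fourier side, by Schur's test. -/
lemma hardy_schur {σ : ℝ} (h1 : 1 / 2 < σ) (h2 : σ < 3 / 2) :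
    ∃ C : ℝ≥0, ∀ (a G : ℝ → ℝ≥0∞), Measurable a →
      (∀ x, 0 < x → G x ≤ ∫⁻ ξ, ENNReal.ofReal (oscBound (x * |ξ|)) * a ξ) →
      ∫⁻ x in Ioi 0, G x ^ 2 * ENNReal.ofReal (x ^ (-(2 * σ))) ≤
        C * ∫⁻ ξ, ENNReal.ofReal (|ξ| ^ (2 * σ)) * a ξ ^ 2 := by
  have hosc := measurable_oscBound
  -- The Schur exponent. As `p - 1 - 2σ = -p`, the integrals in `ξ` and in `x` both reduce to `K`,
  -- which converges for `1 < p < 2`, that is, for `1/2 < σ < 3/2`.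
  set p := σ + 1 / 2 with hp
  set K := ∫⁻ u in Ioi 0, ENNReal.ofReal (oscBound u) * ENNReal.ofReal (u ^ (-p)) with hK
  have hKt : K < ⊤ := by
    refine lintegral_mul_rpow_lt_top (A := 2 * Real.pi) (B := 2) (a := 1)
      (by positivity) (fun u _ => ?_) (fun u _ => min_le_left _ _) (by linarith) (by linarith)
    rw [Real.rpow_one]
    exact min_le_right _ _
  refine ⟨(2 * K ^ 2).toNNReal, fun a G ha hG => ?_⟩
  rw [ENNReal.coe_toNNReal (by finiteness)]
  have hscale : ∀ c : ℝ, 0 < c →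
      ∫⁻ x in Ioi 0, ENNReal.ofReal (oscBound (c * x)) * ENNReal.ofReal (x ^ (-p)) =
        ENNReal.ofReal (c ^ (p - 1)) * K := fun c hc =>
    lintegral_Ioi_comp_mul_rpow hc p (fun u => ENNReal.ofReal (oscBound u))
  have hpt : ∀ x, 0 < x → G x ^ 2 ≤ 2 * (ENNReal.ofReal (x ^ (p - 1)) * K) *
      ∫⁻ ξ, ENNReal.ofReal (oscBound (x * |ξ|)) * (ENNReal.ofReal (|ξ| ^ p) * a ξ ^ 2) := by
    intro x hx
    -- Half of the kernel goes to each factor of Cauchy–Schwarz, with the mutually inverse weights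
    -- `|ξ|^{∓p/2}`.
    let m : ℝ → ℝ≥0∞ := fun ξ => ENNReal.ofReal (oscBound (x * |ξ|)) ^ (1 / 2 : ℝ)
    have hm2 : ∀ ξ, m ξ ^ 2 = ENNReal.ofReal (oscBound (x * |ξ|)) := fun ξ => by
      simp only [m]
      rw [← ENNReal.rpow_natCast, ← ENNReal.rpow_mul]
      norm_num
    calc G x ^ 2 ≤ (∫⁻ ξ, ENNReal.ofReal (oscBound (x * |ξ|)) * a ξ) ^ 2 := by
          gcongr; exact hG x hx
      _ = (∫⁻ ξ, (m ξ * ENNReal.ofReal (|ξ| ^ (-p / 2))) *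
            (m ξ * (ENNReal.ofReal (|ξ| ^ (p / 2)) * a ξ))) ^ 2 := by
          congr 1
          refine lintegral_congr_ae ?_
          filter_upwards [compl_mem_ae_iff.2 (measure_singleton (0 : ℝ))] with ξ hξ
          have hξ0 : 0 < |ξ| := abs_pos.2 hξ
          rw [← hm2]
          have e : ENNReal.ofReal (|ξ| ^ (-p / 2)) * ENNReal.ofReal (|ξ| ^ (p / 2)) = 1 := by
            rw [← ENNReal.ofReal_mul (by positivity), ← Real.rpow_add hξ0]
            ring_nf
            simp
          calc m ξ ^ 2 * a ξ = m ξ ^ 2 *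
                (ENNReal.ofReal (|ξ| ^ (-p / 2)) * ENNReal.ofReal (|ξ| ^ (p / 2))) * a ξ := by
                rw [e, mul_one]
            _ = _ := by ring
      _ ≤ (∫⁻ ξ, (m ξ * ENNReal.ofReal (|ξ| ^ (-p / 2))) ^ 2) *
            ∫⁻ ξ, (m ξ * (ENNReal.ofReal (|ξ| ^ (p / 2)) * a ξ)) ^ 2 :=
          lintegral_mul_sq_le _ (by fun_prop) (by fun_prop)
      _ = (∫⁻ ξ, ENNReal.ofReal (oscBound (x * |ξ|)) * ENNReal.ofReal (|ξ| ^ (-p))) *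
            ∫⁻ ξ, ENNReal.ofReal (oscBound (x * |ξ|)) * (ENNReal.ofReal (|ξ| ^ p) * a ξ ^ 2) := by
          have e : ∀ (r : ℝ) (ξ : ℝ), ENNReal.ofReal (|ξ| ^ (r / 2)) ^ 2 =
              ENNReal.ofReal (|ξ| ^ r) := fun r ξ => by
            rw [← ENNReal.ofReal_pow (by positivity), ← Real.rpow_natCast, ← Real.rpow_mul
              (abs_nonneg _)]
            congr 2
            push_cast
            ring
          simp_rw [mul_pow, hm2, e]
      _ = _ := by
          rw [lintegral_comp_abs
            (fun ξ => ENNReal.ofReal (oscBound (x * ξ)) * ENNReal.ofReal (ξ ^ (-p))), hscale x hx]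
  calc ∫⁻ x in Ioi 0, G x ^ 2 * ENNReal.ofReal (x ^ (-(2 * σ)))
      ≤ ∫⁻ x in Ioi 0, ∫⁻ ξ, 2 * K * (ENNReal.ofReal (|ξ| ^ p) * a ξ ^ 2) *
          (ENNReal.ofReal (oscBound (|ξ| * x)) * ENNReal.ofReal (x ^ (-p))) := by
        refine setLIntegral_mono' measurableSet_Ioi fun x hx => ?_
        have hx0 : 0 < x := hx
        refine (mul_le_mul_left (hpt x hx) _).trans (le_of_eq ?_)
        have e1 : ENNReal.ofReal (x ^ (-p)) =
            ENNReal.ofReal (x ^ (p - 1)) * ENNReal.ofReal (x ^ (-(2 * σ))) := by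
          rw [← ENNReal.ofReal_mul (by positivity), ← Real.rpow_add hx0]
          congr 2
          rw [hp]; ring
        rw [mul_right_comm, ← lintegral_const_mul _ (by fun_prop)]
        refine lintegral_congr fun ξ => ?_
        rw [e1, mul_comm x]
        ring
    _ = ∫⁻ ξ, ∫⁻ x in Ioi 0, 2 * K * (ENNReal.ofReal (|ξ| ^ p) * a ξ ^ 2) *
          (ENNReal.ofReal (oscBound (|ξ| * x)) * ENNReal.ofReal (x ^ (-p))) := by
        refine lintegral_lintegral_swap (Measurable.aemeasurable ?_)
        unfold Function.uncurry
        fun_prop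
    _ = ∫⁻ ξ, 2 * K ^ 2 * (ENNReal.ofReal (|ξ| ^ (2 * σ)) * a ξ ^ 2) := by
        refine lintegral_congr_ae ?_
        filter_upwards [compl_mem_ae_iff.2 (measure_singleton (0 : ℝ))] with ξ hξ
        have hξ0 : 0 < |ξ| := abs_pos.2 hξ
        rw [lintegral_const_mul _ (by fun_prop), hscale _ hξ0]
        have e1 : ENNReal.ofReal (|ξ| ^ (2 * σ)) =
            ENNReal.ofReal (|ξ| ^ p) * ENNReal.ofReal (|ξ| ^ (p - 1)) := by
          rw [← ENNReal.ofReal_mul (by positivity), ← Real.rpow_add hξ0]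
          congr 2
          rw [hp]; ring
        rw [e1]
        ring
    _ = _ := lintegral_const_mul _ (by fun_prop)

lemma norm_exp_sub_one_le_oscBound {x : ℝ} (hx : 0 < x) (ξ : ℝ) :
    ‖Complex.exp (((2 * Real.pi * (x * ξ) : ℝ) : ℂ) * Complex.I) - 1‖ ≤ oscBound (x * |ξ|) := by
  refine le_min ?_ ?_
  · refine (norm_sub_le _ _).trans ?_
    rw [Complex.norm_exp_ofReal_mul_I]
    norm_num
  · have h := Real.norm_exp_I_mul_ofReal_sub_one_le (x := 2 * Real.pi * (x * ξ))
    rw [mul_comm] at h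
    refine h.trans (le_of_eq ?_)
    rw [Real.norm_eq_abs, abs_mul (2 * Real.pi), abs_mul x, abs_of_pos hx, abs_of_pos Real.two_pi_pos]

/-! ### Second differences of a function cut off at the origin. -/

/-- For `x ≥ h` all three points lie in the half line and nothing changes. For `x < h` the left
point drops out and the other two lie below `2h`. -/
lemma enorm_secondDiff_indicator_le (g : ℝ → ℂ) {h : ℝ} (hh : 0 < h) (x : ℝ) :
    ‖secondDiff h ((Ici (0 : ℝ)).indicator g) x‖ₑ ^ 2 ≤ ‖secondDiff h g x‖ₑ ^ 2 +
      3 * (Ico 0 (2 * h)).indicator (fun y => ‖g y‖ₑ ^ 2) (x + h) +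
      12 * (Ico 0 (2 * h)).indicator (fun y => ‖g y‖ₑ ^ 2) x := by
  by_cases hx : 0 ≤ x - h
  · have e : secondDiff h ((Ici (0 : ℝ)).indicator g) x = secondDiff h g x := by
      unfold secondDiff
      rw [indicator_of_mem (show x + h ∈ Ici 0 by simp; linarith),
        indicator_of_mem (show x ∈ Ici 0 by simp; linarith),
        indicator_of_mem (show x - h ∈ Ici 0 from hx)]
    rw [e, add_assoc]
    exact le_self_add
  · push Not at hx
    have e0 : (Ici (0 : ℝ)).indicator g (x - h) = 0 :=
      indicator_of_notMem (by simpa using hx) _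
    have key : ∀ y, y < 2 * h → ‖(Ici (0 : ℝ)).indicator g y‖ₑ ^ 2 ≤
        (Ico 0 (2 * h)).indicator (fun y => ‖g y‖ₑ ^ 2) y := fun y hy => by
      by_cases hy0 : 0 ≤ y
      · rw [indicator_of_mem (show y ∈ Ici 0 from hy0),
          indicator_of_mem (show y ∈ Ico 0 (2 * h) from ⟨hy0, hy⟩)]
      · rw [indicator_of_notMem (by simpa using hy0)]
        simp
    have h1 := enorm_sub_add_sq_le ((Ici (0 : ℝ)).indicator g (x + h))
      ((Ici (0 : ℝ)).indicator g x) ((Ici (0 : ℝ)).indicator g (x - h))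
    rw [e0] at h1
    unfold secondDiff
    rw [e0]
    refine h1.trans ?_
    simp only [enorm_zero, ne_eq, OfNat.ofNat_ne_zero, not_false_eq_true, zero_pow, mul_zero,
      add_zero]
    refine (add_le_add (mul_le_mul_right (key _ (by linarith)) _)
      (mul_le_mul_right (key _ (by linarith)) _)).trans ?_
    rw [add_assoc]
    exact le_add_self

lemma lintegral_secondDiff_indicator_le {g : ℝ → ℂ} (hgm : Measurable g) {h : ℝ} (hh : 0 < h) :
    ∫⁻ x, ‖secondDiff h ((Ici (0 : ℝ)).indicator g) x‖ₑ ^ 2 ≤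
      (∫⁻ x, ‖secondDiff h g x‖ₑ ^ 2) + 15 * ∫⁻ x in Ico 0 (2 * h), ‖g x‖ₑ ^ 2 := by
  have hm : Measurable fun x => ‖secondDiff h g x‖ₑ ^ 2 := by unfold secondDiff; fun_prop
  have hi : Measurable ((Ico 0 (2 * h)).indicator (fun y => ‖g y‖ₑ ^ 2)) :=
    Measurable.indicator (by fun_prop) measurableSet_Ico
  have hi' : Measurable fun x => (Ico 0 (2 * h)).indicator (fun y => ‖g y‖ₑ ^ 2) (x + h) :=
    hi.comp (measurable_id.add_const h)
  refine (lintegral_mono (enorm_secondDiff_indicator_le g hh)).trans (le_of_eq ?_)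
  rw [lintegral_add_left (by fun_prop), lintegral_add_left hm, lintegral_const_mul _ hi',
    lintegral_const_mul _ hi, lintegral_add_right_eq_self
      ((Ico 0 (2 * h)).indicator (fun y => ‖g y‖ₑ ^ 2)) h, lintegral_indicator measurableSet_Ico]
  ring

/-- The second difference energy of the restriction to the half line. -/
lemma diffEnergy_indicator_le {σ : ℝ} (hσ : 0 < σ) :
    ∃ C : ℝ≥0, ∀ g : ℝ → ℂ, Measurable g →
      diffEnergy σ ((Ici (0 : ℝ)).indicator g) ≤ diffEnergy σ g + C * hardyIntegral σ g := by
  -- For fixed `x` only the steps `h > x/2` contribute, and `∫_{x/2}^∞ h^{-1-2σ} dh = (x/2)^{-2σ} /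
  -- (2σ)` is the Hardy weight with its constant.
  refine ⟨Real.toNNReal (15 * (2⁻¹ ^ (-(2 * σ)) / (2 * σ))), fun g hgm => ?_⟩
  have hms : Measurable fun z : ℝ × ℝ => secondDiff z.1 g z.2 :=
    measurable_secondDiff_uncurry hgm measurable_fst measurable_snd
  have hms' : Measurable fun h : ℝ => ∫⁻ x, ‖secondDiff h g x‖ₑ ^ 2 :=
    Measurable.lintegral_prod_right' (f := fun z : ℝ × ℝ => ‖secondDiff z.1 g z.2‖ₑ ^ 2)
      (by fun_prop)
  have hset : MeasurableSet {z : ℝ × ℝ | z.2 < 2 * z.1} :=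
    measurableSet_lt (by fun_prop) (by fun_prop)
  calc diffEnergy σ ((Ici (0 : ℝ)).indicator g)
      ≤ ∫⁻ h in Ioi 0, ((∫⁻ x, ‖secondDiff h g x‖ₑ ^ 2) * ENNReal.ofReal (h ^ (-(1 + 2 * σ))) +
          15 * ∫⁻ x in Ioi 0, {z : ℝ × ℝ | z.2 < 2 * z.1}.indicator
            (fun z => ‖g z.2‖ₑ ^ 2 * ENNReal.ofReal (z.1 ^ (-(1 + 2 * σ)))) (h, x)) := by
        refine setLIntegral_mono' measurableSet_Ioi fun h hh => ?_
        refine (mul_le_mul_left (lintegral_secondDiff_indicator_le hgm hh) _).trans (le_of_eq ?_)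
        rw [add_mul, mul_assoc 15]
        congr 2
        rw [← lintegral_mul_const' _ _ ENNReal.ofReal_ne_top, ← lintegral_indicator measurableSet_Ico,
          restrict_Ioi_eq_restrict_Ici, ← lintegral_indicator measurableSet_Ici]
        refine lintegral_congr fun x => ?_
        by_cases hx : 0 ≤ x <;> by_cases hx2 : x < 2 * h <;> simp [indicator, hx, hx2]
    _ = diffEnergy σ g + 15 * ∫⁻ h in Ioi 0, ∫⁻ x in Ioi 0,
          {z : ℝ × ℝ | z.2 < 2 * z.1}.indicator
            (fun z => ‖g z.2‖ₑ ^ 2 * ENNReal.ofReal (z.1 ^ (-(1 + 2 * σ)))) (h, x) := by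
        rw [lintegral_add_left (by fun_prop), lintegral_const_mul' _ _ (by norm_num)]
        rfl
    _ = diffEnergy σ g + 15 * ∫⁻ x in Ioi 0, ∫⁻ h in Ioi 0,
          {z : ℝ × ℝ | z.2 < 2 * z.1}.indicator
            (fun z => ‖g z.2‖ₑ ^ 2 * ENNReal.ofReal (z.1 ^ (-(1 + 2 * σ)))) (h, x) := by
        rw [lintegral_lintegral_swap]
        refine (Measurable.indicator ?_ hset).aemeasurable
        fun_prop
    _ = _ := by
        congr 1
        unfold hardyIntegral
        rw [← lintegral_const_mul' _ _ (by norm_num), ← lintegral_const_mul' _ _ (by simp)]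
        refine setLIntegral_congr_fun measurableSet_Ioi fun x hx => ?_
        have hx0 : 0 < x := hx
        have e : ∫⁻ h in Ioi 0, {z : ℝ × ℝ | z.2 < 2 * z.1}.indicator
            (fun z => ‖g z.2‖ₑ ^ 2 * ENNReal.ofReal (z.1 ^ (-(1 + 2 * σ)))) (h, x) =
            ∫⁻ h in Ioi (2⁻¹ * x), ‖g x‖ₑ ^ 2 * ENNReal.ofReal (h ^ (-(1 + 2 * σ))) := by
          rw [← lintegral_indicator measurableSet_Ioi, ← lintegral_indicator measurableSet_Ioi]
          refine lintegral_congr fun h => ?_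
          by_cases hh : x < 2 * h
          · have h1 : 0 < h := by linarith
            have h2 : 2⁻¹ * x < h := by linarith
            simp [indicator, hh, h1, h2]
          · have h2 : ¬ 2⁻¹ * x < h := by intro h3; apply hh; linarith
            simp [indicator, hh, h2]
        rw [e, lintegral_const_mul' _ _ (by finiteness), lintegral_Ioi_rpow (by linarith)
          (by positivity), Real.mul_rpow (by norm_num) hx0.le]
        change _ = ENNReal.ofReal _ * _
        rw [mul_left_comm, mul_left_comm (ENNReal.ofReal _) (‖g x‖ₑ ^ 2),
          ← ENNReal.ofReal_mul (by positivity)]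
        congr 1
        rw [show (15 : ℝ≥0∞) = ENNReal.ofReal 15 by simp, ← ENNReal.ofReal_mul (by norm_num)]
        congr 1
        ring

/-! ### The Sobolev weight and norm. -/

/-- The Sobolev weight in Mathlib's frequency variable. -/
def freqWeight (σ ξ : ℝ) : ℝ≥0∞ := ENNReal.ofReal (japaneseBracket (2 * Real.pi * ξ) ^ σ)

lemma one_le_japaneseBracket (ξ : ℝ) : 1 ≤ japaneseBracket ξ := by
  unfold japaneseBracket
  linarith [abs_nonneg ξ]

lemma japaneseBracket_pos (ξ : ℝ) : 0 < japaneseBracket ξ :=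
  one_pos.trans_le (one_le_japaneseBracket ξ)

lemma measurable_freqWeight (σ : ℝ) : Measurable (freqWeight σ) := by
  unfold freqWeight japaneseBracket
  fun_prop

lemma one_le_freqWeight {σ : ℝ} (hσ : 0 ≤ σ) (ξ : ℝ) : 1 ≤ freqWeight σ ξ := by
  rw [freqWeight, ENNReal.one_le_ofReal]
  exact Real.one_le_rpow (one_le_japaneseBracket _) hσ

lemma freqWeight_sq (σ ξ : ℝ) :
    freqWeight σ ξ ^ 2 = ENNReal.ofReal (japaneseBracket (2 * Real.pi * ξ) ^ (2 * σ)) := by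
  have h := (japaneseBracket_pos (2 * Real.pi * ξ)).le
  rw [freqWeight, ← ENNReal.ofReal_pow (Real.rpow_nonneg h _), ← Real.rpow_natCast,
    ← Real.rpow_mul h]
  congr 2
  push_cast
  ring

/-- From `⟨a + b⟩ ≤ ⟨a⟩⟨b⟩`; it distributes the weight over the two factors of a convolution. -/
lemma freqWeight_add_le {σ : ℝ} (hσ : 0 ≤ σ) (a b : ℝ) :
    freqWeight σ (a + b) ≤ freqWeight σ a * freqWeight σ b := by
  have ha := (japaneseBracket_pos (2 * Real.pi * a)).le
  have hb := (japaneseBracket_pos (2 * Real.pi * b)).le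
  rw [freqWeight, freqWeight, freqWeight, ← ENNReal.ofReal_mul (by positivity),
    ← Real.mul_rpow ha hb]
  refine ENNReal.ofReal_le_ofReal (Real.rpow_le_rpow (japaneseBracket_pos _).le ?_ hσ)
  unfold japaneseBracket
  rw [mul_add]
  nlinarith [abs_add_le (2 * Real.pi * a) (2 * Real.pi * b),
    mul_nonneg (abs_nonneg (2 * Real.pi * a)) (abs_nonneg (2 * Real.pi * b))]

/-- With `abs_rpow_le_freqWeight_sq`, this splits the inhomogeneous norm into an `L²` part and the
homogeneous part governed by second differences. The constant comes from `1 + 2π|ξ| ≤ 4π max(1,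
|ξ|)`. -/
lemma freqWeight_sq_le {σ : ℝ} (hσ : 0 < σ) (ξ : ℝ) :
    freqWeight σ ξ ^ 2 ≤
      ENNReal.ofReal ((4 * Real.pi) ^ (2 * σ)) * (1 + ENNReal.ofReal (|ξ| ^ (2 * σ))) := by
  have hξ := abs_nonneg ξ
  rw [freqWeight_sq, ← ENNReal.ofReal_one, ← ENNReal.ofReal_add zero_le_one (by positivity),
    ← ENNReal.ofReal_mul (by positivity)]
  refine ENNReal.ofReal_le_ofReal ?_
  have h1 : japaneseBracket (2 * Real.pi * ξ) ≤ 4 * Real.pi * max 1 |ξ| := by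
    unfold japaneseBracket
    rw [abs_mul, abs_of_pos Real.two_pi_pos]
    have h3 := Real.pi_gt_three
    have h4 := le_max_left 1 |ξ|
    have h5 := le_max_right 1 |ξ|
    nlinarith
  calc japaneseBracket (2 * Real.pi * ξ) ^ (2 * σ)
      ≤ (4 * Real.pi * max 1 |ξ|) ^ (2 * σ) :=
        Real.rpow_le_rpow (japaneseBracket_pos _).le h1 (by positivity)
    _ = (4 * Real.pi) ^ (2 * σ) * max 1 |ξ| ^ (2 * σ) :=
        Real.mul_rpow (by positivity) (by positivity)
    _ ≤ _ := by
        gcongr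
        rcases max_cases 1 |ξ| with ⟨e, _⟩ | ⟨e, _⟩
        · rw [e, Real.one_rpow]
          linarith [Real.rpow_nonneg hξ (2 * σ)]
        · rw [e]; linarith

lemma abs_rpow_le_freqWeight_sq {σ : ℝ} (hσ : 0 < σ) (ξ : ℝ) :
    ENNReal.ofReal (|ξ| ^ (2 * σ)) ≤ freqWeight σ ξ ^ 2 := by
  rw [freqWeight_sq]
  refine ENNReal.ofReal_le_ofReal (Real.rpow_le_rpow (abs_nonneg ξ) ?_ (by positivity))
  unfold japaneseBracket
  rw [abs_mul, abs_of_pos Real.two_pi_pos]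
  have h3 := Real.pi_gt_three
  have := abs_nonneg ξ
  nlinarith

lemma lintegral_comp_mul_left {c : ℝ} (hc : 0 < c) (G : ℝ → ℝ≥0∞) :
    ∫⁻ x, G (c * x) = ENNReal.ofReal c⁻¹ * ∫⁻ u, G u := by
  have h := (Homeomorph.mulLeft₀ c hc.ne').measurableEmbedding.lintegral_map
    (μ := (volume : Measure ℝ)) G
  have e : Measure.map (Homeomorph.mulLeft₀ c hc.ne') (volume : Measure ℝ) =
      ENNReal.ofReal |c⁻¹| • volume := Real.map_volume_mul_left hc.ne'
  rw [e, lintegral_smul_measure, abs_of_pos (by positivity)] at h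
  exact h.symm

lemma lintegral_comp_div {c : ℝ} (hc : 0 < c) (G : ℝ → ℝ≥0∞) :
    ∫⁻ x, G (x / c) = ENNReal.ofReal c * ∫⁻ u, G u := by
  have := lintegral_comp_mul_left (inv_pos.2 hc) G
  rw [inv_inv] at this
  rw [← this]
  simp only [div_eq_inv_mul]

lemma sobolevNorm_sq (σ : ℝ) {g : ℝ → ℂ} (hg : MemLp g 2 volume) :
    sobolevNorm σ g ^ 2 =
      ENNReal.ofReal (2 * Real.pi) * ∫⁻ ξ, (freqWeight σ ξ * ‖plancherel g ξ‖ₑ) ^ 2 := by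
  rw [sobolevNorm, if_pos hg, eLpNorm_two_sq, ← lintegral_comp_div Real.two_pi_pos]
  refine lintegral_congr fun ξ => ?_
  rw [enorm_mul, fourierL2_eq_plancherel, freqWeight, mul_div_cancel₀ _ Real.two_pi_pos.ne']
  congr 2
  rw [← ofReal_norm, Complex.norm_real, Real.norm_of_nonneg
    (Real.rpow_nonneg (japaneseBracket_pos ξ).le _)]

lemma memLp_of_sobolevNorm_ne_top {σ : ℝ} {g : ℝ → ℂ} (h : sobolevNorm σ g ≠ ⊤) :
    MemLp g 2 volume := by
  by_contra hg
  exact h (by simp [sobolevNorm, hg])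

lemma sobolevNorm_congr (σ : ℝ) {g g' : ℝ → ℂ} (h : g =ᵐ[volume] g') :
    sobolevNorm σ g = sobolevNorm σ g' := by
  have e : fourierL2 g = fourierL2 g' := by
    ext ξ
    rw [fourierL2_eq_plancherel, fourierL2_eq_plancherel, plancherel_congr h]
  have hiff := memLp_congr_ae (p := 2) h
  unfold sobolevNorm
  rw [e]
  by_cases hg : MemLp g 2 (volume : Measure ℝ)
  · rw [if_pos hg, if_pos (hiff.1 hg)]
  · rw [if_neg hg, if_neg (fun h' => hg (hiff.2 h'))]

lemma le_of_sq_le_mul_sq {a b : ℝ≥0∞} {C : ℝ≥0∞} (h : a ^ 2 ≤ C ^ 2 * b ^ 2) : a ≤ C * b := by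
  rw [← mul_pow] at h
  exact (ENNReal.pow_le_pow_left_iff two_ne_zero).1 h

lemma exists_sq_eq (C : ℝ≥0) : ((NNReal.sqrt C : ℝ≥0) : ℝ≥0∞) ^ 2 = C := by
  rw [← ENNReal.coe_pow, NNReal.sq_sqrt]

lemma sobolevNorm_le_of_sq_le {σ : ℝ} {f g : ℝ → ℂ} (hf : MemLp f 2 volume)
    (hg : MemLp g 2 volume) {C : ℝ≥0}
    (h : ∫⁻ ξ, (freqWeight σ ξ * ‖plancherel f ξ‖ₑ) ^ 2 ≤
      C * ∫⁻ ξ, (freqWeight σ ξ * ‖plancherel g ξ‖ₑ) ^ 2) :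
    sobolevNorm σ f ≤ NNReal.sqrt C * sobolevNorm σ g := by
  refine le_of_sq_le_mul_sq ?_
  rw [exists_sq_eq, sobolevNorm_sq σ hf, sobolevNorm_sq σ hg, mul_left_comm]
  gcongr

/-! ### Boundedness of the restriction to the half line. -/

lemma memLp_indicator_Ici {g : ℝ → ℂ} (hg : MemLp g 2 volume) :
    MemLp ((Ici (0 : ℝ)).indicator g) 2 volume := hg.indicator measurableSet_Ici

/-- Restriction to the half line is bounded as soon as a Hardy inequality is available. -/
lemma sobolevNorm_indicator_le_of_hardy {σ : ℝ} (h0 : 0 < σ) (h2 : σ < 2) (CH : ℝ≥0) :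
    ∃ C : ℝ≥0, ∀ g : ℝ → ℂ, Measurable g → MemLp g 2 volume →
      hardyIntegral σ g ≤ CH * ∫⁻ ξ, ENNReal.ofReal (|ξ| ^ (2 * σ)) * ‖plancherel g ξ‖ₑ ^ 2 →
      sobolevNorm σ ((Ici (0 : ℝ)).indicator g) ≤ C * sobolevNorm σ g := by
  obtain ⟨CI, hCI⟩ := diffEnergy_indicator_le h0
  have hκ := diffEnergyConst_lt_top h0 h2
  have hκ0 := diffEnergyConst_ne_zero σ
  set κ := diffEnergyConst σ
  -- The `1` accounts for the `L²` part; the other summand is the energy bound, divided by `κ` to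
  -- return to the Fourier side.
  let M : ℝ≥0∞ := ENNReal.ofReal ((4 * Real.pi) ^ (2 * σ)) * (1 + κ⁻¹ * (κ + CI * CH))
  have hM : M ≠ ⊤ := by
    have : κ⁻¹ ≠ ⊤ := ENNReal.inv_ne_top.2 hκ0
    finiteness
  refine ⟨NNReal.sqrt M.toNNReal, fun g hgm hg hH => ?_⟩
  have hg' := memLp_indicator_Ici hg
  refine sobolevNorm_le_of_sq_le hg' hg ?_
  rw [ENNReal.coe_toNNReal hM]
  set u := (Ici (0 : ℝ)).indicator g
  set N := ∫⁻ ξ, (freqWeight σ ξ * ‖plancherel g ξ‖ₑ) ^ 2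
  have hmg := measurable_plancherel g
  have hmu := measurable_plancherel u
  set E := ∫⁻ ξ, ENNReal.ofReal (|ξ| ^ (2 * σ)) * ‖plancherel g ξ‖ₑ ^ 2
  have hEN : E ≤ N := lintegral_mono fun ξ => by
    rw [mul_pow]; gcongr; exact abs_rpow_le_freqWeight_sq h0 ξ
  have hgN : ∫⁻ ξ, ‖plancherel g ξ‖ₑ ^ 2 ≤ N := lintegral_mono fun ξ => by
    rw [mul_pow]
    exact le_mul_of_one_le_left' (one_le_pow₀ (one_le_freqWeight h0.le ξ))
  have hEu : ∫⁻ ξ, ENNReal.ofReal (|ξ| ^ (2 * σ)) * ‖plancherel u ξ‖ₑ ^ 2 ≤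
      κ⁻¹ * (κ + CI * CH) * E := by
    calc _ = κ⁻¹ * diffEnergy σ u := by
          rw [diffEnergy_eq h0 hg', ← mul_assoc, ENNReal.inv_mul_cancel hκ0 hκ.ne, one_mul]
      _ ≤ κ⁻¹ * (diffEnergy σ g + CI * hardyIntegral σ g) := by gcongr; exact hCI g hgm
      _ ≤ κ⁻¹ * (κ * E + CI * (CH * E)) := by
          rw [diffEnergy_eq h0 hg]; gcongr
      _ = _ := by ring
  have hu2 : ∫⁻ ξ, ‖plancherel u ξ‖ₑ ^ 2 ≤ ∫⁻ ξ, ‖plancherel g ξ‖ₑ ^ 2 := by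
    rw [lintegral_plancherel hg', lintegral_plancherel hg]
    refine lintegral_mono fun x => ?_
    gcongr
    exact enorm_indicator_le_enorm_self _ _
  calc ∫⁻ ξ, (freqWeight σ ξ * ‖plancherel u ξ‖ₑ) ^ 2
      ≤ ∫⁻ ξ, ENNReal.ofReal ((4 * Real.pi) ^ (2 * σ)) * (‖plancherel u ξ‖ₑ ^ 2 +
          ENNReal.ofReal (|ξ| ^ (2 * σ)) * ‖plancherel u ξ‖ₑ ^ 2) := by
        refine lintegral_mono fun ξ => ?_
        rw [mul_pow]
        refine (mul_le_mul_left (freqWeight_sq_le h0 ξ) _).trans (le_of_eq ?_)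
        ring
    _ = ENNReal.ofReal ((4 * Real.pi) ^ (2 * σ)) * ((∫⁻ ξ, ‖plancherel u ξ‖ₑ ^ 2) +
          ∫⁻ ξ, ENNReal.ofReal (|ξ| ^ (2 * σ)) * ‖plancherel u ξ‖ₑ ^ 2) := by
        rw [lintegral_const_mul' _ _ ENNReal.ofReal_ne_top, lintegral_add_left (by fun_prop)]
    _ ≤ ENNReal.ofReal ((4 * Real.pi) ^ (2 * σ)) * (N + κ⁻¹ * (κ + CI * CH) * N) :=
        mul_le_mul_right (add_le_add (hu2.trans hgN)
          (hEu.trans (mul_le_mul_right hEN _))) _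
    _ = M * N := by simp only [M]; ring

lemma exists_measurable_rep {g : ℝ → ℂ} (hg : MemLp g 2 volume) :
    ∃ g', Measurable g' ∧ g =ᵐ[volume] g' :=
  ⟨hg.1.mk g, hg.1.stronglyMeasurable_mk.measurable, hg.1.ae_eq_mk⟩

lemma indicator_congr_ae {g g' : ℝ → ℂ} (h : g =ᵐ[volume.restrict (Ioi (0 : ℝ))] g') :
    (Ici (0 : ℝ)).indicator g =ᵐ[volume] (Ici (0 : ℝ)).indicator g' := by
  rw [restrict_Ioi_eq_restrict_Ici] at h
  exact (ae_eq_restrict_iff_indicator_ae_eq measurableSet_Ici).1 h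

lemma lintegral_freqWeight_inv_sq_lt_top {σ : ℝ} (hσ : 1 / 2 < σ) :
    ∫⁻ ξ, ((freqWeight σ ξ)⁻¹) ^ 2 < ⊤ := by
  have hi : Integrable fun x : ℝ => (1 + ‖x‖) ^ (-(2 * σ)) := by
    refine integrable_one_add_norm ?_
    simp only [Module.finrank_self, Nat.cast_one]
    linarith
  refine lt_of_le_of_lt (lintegral_mono fun ξ => ?_) hi.lintegral_lt_top
  have hj := japaneseBracket_pos (2 * Real.pi * ξ)
  rw [← ENNReal.inv_pow, freqWeight_sq, ← ENNReal.ofReal_inv_of_pos (by positivity),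
    ← Real.rpow_neg hj.le]
  refine ENNReal.ofReal_le_ofReal (Real.rpow_le_rpow_of_nonpos (by positivity) ?_ (by linarith))
  unfold japaneseBracket
  rw [abs_mul, abs_of_pos Real.two_pi_pos, Real.norm_eq_abs]
  have h3 := Real.pi_gt_three
  have := abs_nonneg ξ
  nlinarith

lemma lintegral_weighted_lt_top {σ : ℝ} {g : ℝ → ℂ} (h : sobolevNorm σ g ≠ ⊤) :
    ∫⁻ ξ, (freqWeight σ ξ * ‖plancherel g ξ‖ₑ) ^ 2 < ⊤ := by
  have h1 := sobolevNorm_sq σ (memLp_of_sobolevNorm_ne_top h)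
  by_contra hcon
  rw [not_lt, top_le_iff] at hcon
  rw [hcon, ENNReal.mul_top (by simp [Real.pi_pos])] at h1
  exact h (by simpa using h1)

/-- Cauchy–Schwarz against the inverse weight, which is square integrable for `σ > 1/2`. This gives
the continuous representative and hence a trace. -/
lemma integrable_plancherel {σ : ℝ} (hσ : 1 / 2 < σ) {g : ℝ → ℂ} (h : sobolevNorm σ g ≠ ⊤) :
    Integrable (plancherel g) := by
  have hw := measurable_freqWeight σ
  have hm := measurable_plancherel g
  refine ⟨hm.aestronglyMeasurable, ?_⟩
  have e : ∀ ξ, ‖plancherel g ξ‖ₑ = (freqWeight σ ξ)⁻¹ * (freqWeight σ ξ * ‖plancherel g ξ‖ₑ) := by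
    intro ξ
    rw [← mul_assoc, ENNReal.inv_mul_cancel, one_mul]
    · exact (one_pos.trans_le (one_le_freqWeight (by linarith) ξ)).ne'
    · exact ENNReal.ofReal_ne_top
  rw [hasFiniteIntegral_iff_enorm]
  have h2 : (∫⁻ ξ, ‖plancherel g ξ‖ₑ) ^ 2 < ⊤ := by
    rw [lintegral_congr e]
    refine (lintegral_mul_sq_le volume (by fun_prop) (by fun_prop)).trans_lt ?_
    exact ENNReal.mul_lt_top (lintegral_freqWeight_inv_sq_lt_top hσ) (lintegral_weighted_lt_top h)
  by_contra hcon
  rw [not_lt, top_le_iff] at hcon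
  simp [hcon] at h2

lemma fourierInv_eq_integral (f : ℝ → ℂ) (t : ℝ) :
    𝓕⁻ f t = ∫ ξ, Complex.exp (((2 * Real.pi * (t * ξ) : ℝ) : ℂ) * Complex.I) * f ξ := by
  rw [Real.fourierInv_eq']
  congr 1

lemma continuous_fourierInv {f : ℝ → ℂ} (hf : Integrable f) : Continuous (𝓕⁻ f) := by
  have hcont : Continuous (𝓕 f) :=
    VectorFourier.fourierIntegral_continuous Real.continuous_fourierChar
      (L := innerₗ ℝ) continuous_inner hf
  have : 𝓕⁻ f = fun x => 𝓕 f (-x) := by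
    ext x; rw [Real.fourierInv_eq_fourier_neg]
  rw [this]
  exact hcont.comp continuous_neg

lemma integrable_exp_mul {f : ℝ → ℂ} (hf : Integrable f) (t : ℝ) :
    Integrable fun ξ : ℝ => Complex.exp (((2 * Real.pi * (t * ξ) : ℝ) : ℂ) * Complex.I) * f ξ := by
  refine hf.bdd_mul (c := 1) (Continuous.aestronglyMeasurable (by fun_prop))
    (.of_forall fun ξ => ?_)
  rw [Complex.norm_exp_ofReal_mul_I]

/-- The vanishing value at `0` allows `e^{2πixξ}` to be replaced by `e^{2πixξ} - 1`, which is small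
for `x|ξ|` small. -/
lemma enorm_fourierInv_le {f : ℝ → ℂ} (hf : Integrable f) (h0 : 𝓕⁻ f 0 = 0) {x : ℝ}
    (hx : 0 < x) : ‖𝓕⁻ f x‖ₑ ≤ ∫⁻ ξ, ENNReal.ofReal (oscBound (x * |ξ|)) * ‖f ξ‖ₑ := by
  have e : 𝓕⁻ f x = ∫ ξ,
      (Complex.exp (((2 * Real.pi * (x * ξ) : ℝ) : ℂ) * Complex.I) - 1) * f ξ := by
    rw [← sub_zero (𝓕⁻ f x), ← h0, fourierInv_eq_integral, fourierInv_eq_integral,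
      ← integral_sub (integrable_exp_mul hf x) (integrable_exp_mul hf 0)]
    simp [sub_mul]
  rw [e]
  refine (enorm_integral_le_lintegral_enorm _).trans (lintegral_mono fun ξ => ?_)
  rw [enorm_mul]
  gcongr
  rw [← ofReal_norm]
  exact ENNReal.ofReal_le_ofReal (norm_exp_sub_one_le_oscBound hx ξ)

/-- The trace condition for an element of `H^σ(ℝ)`, `σ > 1/2`. -/
lemma fourierInv_zero_of_vanishesAtZero {g h : ℝ → ℂ} (hg : MemLp g 2 volume)
    (hi : Integrable (plancherel g)) (hgh : g =ᵐ[volume.restrict (Ioi (0 : ℝ))] h)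
    (hv : VanishesAtZero h) : 𝓕⁻ (plancherel g) 0 = 0 := by
  obtain ⟨k, hk, hkh, hk0⟩ := hv
  have h1 : 𝓕⁻ (plancherel g) =ᵐ[volume.restrict (Ici (0 : ℝ))] k := by
    rw [← restrict_Ioi_eq_restrict_Ici]
    have h0 : g =ᵐ[volume.restrict (Ioi (0 : ℝ))] 𝓕⁻ (plancherel g) :=
      ae_restrict_of_ae (eq_fourierInv_plancherel hg hi)
    exact (h0.symm.trans hgh).trans hkh.symm
  -- Two continuous functions that agree almost everywhere on `[0,∞)` agree at its endpoint too,
  -- since `0` is in the closure of the interior.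
  have h2 := Measure.eqOn_of_ae_eq h1 (continuous_fourierInv hi).continuousOn hk
    (by rw [interior_Ici, closure_Ioi])
  rw [h2 self_mem_Ici, hk0]

lemma hardyIntegral_congr (σ : ℝ) {g g' : ℝ → ℂ} (h : g =ᵐ[volume] g') :
    hardyIntegral σ g = hardyIntegral σ g' := by
  refine lintegral_congr_ae (ae_restrict_of_ae ?_)
  filter_upwards [h] with x hx
  rw [hx]

/-- Restriction to the half line is bounded on `H^σ` for `0 < σ < 3/2`, `σ ≠ 1/2`, on functions
with vanishing trace if `σ > 1/2`. -/
theorem sobolevNorm_indicator_le {σ : ℝ} (h0 : 0 < σ) (h2 : σ < 3 / 2) (h1 : σ ≠ 1 / 2) :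
    ∃ C : ℝ≥0, ∀ g h : ℝ → ℂ, sobolevNorm σ g ≠ ⊤ → g =ᵐ[volume.restrict (Ioi (0 : ℝ))] h →
      (1 / 2 < σ → VanishesAtZero h) →
      sobolevNorm σ ((Ici (0 : ℝ)).indicator h) ≤ C * sobolevNorm σ g := by
  obtain ⟨CH, hCH⟩ : ∃ CH : ℝ≥0, ∀ g h : ℝ → ℂ, Measurable g → sobolevNorm σ g ≠ ⊤ →
      g =ᵐ[volume.restrict (Ioi (0 : ℝ))] h → (1 / 2 < σ → VanishesAtZero h) →
      hardyIntegral σ g ≤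
        CH * ∫⁻ ξ, ENNReal.ofReal (|ξ| ^ (2 * σ)) * ‖plancherel g ξ‖ₑ ^ 2 := by
    rcases lt_or_gt_of_ne h1 with hlt | hgt
    · obtain ⟨C, hC⟩ := hardyIntegral_le_of_lt_half h0 hlt
      refine ⟨C * (diffEnergyConst σ).toNNReal, fun g h hgm hg _ _ => ?_⟩
      have hgL := memLp_of_sobolevNorm_ne_top hg
      refine (hC g hgm hgL).trans (le_of_eq ?_)
      rw [diffEnergy_eq h0 hgL, ENNReal.coe_mul,
        ENNReal.coe_toNNReal (diffEnergyConst_lt_top h0 (by linarith)).ne, mul_assoc]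
    · obtain ⟨C, hC⟩ := hardy_schur hgt h2
      refine ⟨C, fun g h hgm hg hgh hv => ?_⟩
      have hgL := memLp_of_sobolevNorm_ne_top hg
      have hi := integrable_plancherel hgt hg
      have hz := fourierInv_zero_of_vanishesAtZero hgL hi hgh (hv hgt)
      rw [hardyIntegral_congr σ (eq_fourierInv_plancherel hgL hi)]
      exact hC (fun ξ => ‖plancherel g ξ‖ₑ) (fun x => ‖𝓕⁻ (plancherel g) x‖ₑ)
        (measurable_plancherel g).enorm fun x hx => enorm_fourierInv_le hi hz hx
  obtain ⟨C, hC⟩ := sobolevNorm_indicator_le_of_hardy h0 (by linarith : σ < 2) CH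
  refine ⟨C, fun g h hg hgh hv => ?_⟩
  obtain ⟨g', hgm', hgg'⟩ := exists_measurable_rep (memLp_of_sobolevNorm_ne_top hg)
  have hg' : sobolevNorm σ g' ≠ ⊤ := by rwa [← sobolevNorm_congr σ hgg']
  have hgg'' : g =ᵐ[volume.restrict (Ioi (0 : ℝ))] g' := ae_restrict_of_ae hgg'
  have hg'h : g' =ᵐ[volume.restrict (Ioi (0 : ℝ))] h := hgg''.symm.trans hgh
  rw [← sobolevNorm_congr σ (indicator_congr_ae hg'h), sobolevNorm_congr σ hgg']
  exact hC g' hgm' (memLp_of_sobolevNorm_ne_top hg') (hCH g' h hgm' hg' hg'h hv)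

/-! ### Multiplication by a test function. -/

/-- Young's inequality `L¹ * L² ⊆ L²`. -/
lemma lintegral_convolution_sq_le {k v : ℝ → ℝ≥0∞} (hk : Measurable k) (hv : Measurable v) :
    ∫⁻ ξ, (∫⁻ ζ, k (ξ - ζ) * v ζ) ^ 2 ≤ (∫⁻ ξ, k ξ) ^ 2 * ∫⁻ ζ, v ζ ^ 2 := by
  let r : ℝ → ℝ≥0∞ := fun ξ => k ξ ^ (1 / 2 : ℝ)
  have hr : ∀ ξ, r ξ * r ξ = k ξ := fun ξ => by
    simp only [r]
    rw [← sq, ← ENNReal.rpow_natCast, ← ENNReal.rpow_mul]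
    norm_num
  have hrm : Measurable r := by fun_prop
  have hpt : ∀ ξ, (∫⁻ ζ, k (ξ - ζ) * v ζ) ^ 2 ≤
      (∫⁻ ζ, k ζ) * ∫⁻ ζ, k (ξ - ζ) * v ζ ^ 2 := by
    intro ξ
    calc (∫⁻ ζ, k (ξ - ζ) * v ζ) ^ 2 = (∫⁻ ζ, r (ξ - ζ) * (r (ξ - ζ) * v ζ)) ^ 2 := by
          simp_rw [← mul_assoc, hr]
      _ ≤ (∫⁻ ζ, r (ξ - ζ) ^ 2) * ∫⁻ ζ, (r (ξ - ζ) * v ζ) ^ 2 :=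
          lintegral_mul_sq_le _ (by fun_prop) (by fun_prop)
      _ = _ := by
          simp_rw [mul_pow, sq (r _), hr]
          rw [lintegral_sub_left_eq_self]
  calc ∫⁻ ξ, (∫⁻ ζ, k (ξ - ζ) * v ζ) ^ 2
      ≤ ∫⁻ ξ, (∫⁻ ζ, k ζ) * ∫⁻ ζ, k (ξ - ζ) * v ζ ^ 2 := lintegral_mono hpt
    _ = (∫⁻ ζ, k ζ) * ∫⁻ ξ, ∫⁻ ζ, k (ξ - ζ) * v ζ ^ 2 := by
        refine lintegral_const_mul _ ?_
        exact Measurable.lintegral_prod_right' (f := fun z : ℝ × ℝ => k (z.1 - z.2) * v z.2 ^ 2)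
          (by fun_prop)
    _ = (∫⁻ ζ, k ζ) * ∫⁻ ζ, ∫⁻ ξ, k (ξ - ζ) * v ζ ^ 2 := by
        rw [lintegral_lintegral_swap]
        refine Measurable.aemeasurable ?_
        unfold Function.uncurry
        fun_prop
    _ = (∫⁻ ζ, k ζ) * ∫⁻ ζ, (∫⁻ ξ, k ξ) * v ζ ^ 2 := by
        congr 1
        refine lintegral_congr fun ζ => ?_
        rw [lintegral_mul_const _ (by fun_prop), lintegral_sub_right_eq_self]
    _ = _ := by
        rw [lintegral_const_mul _ (by fun_prop)]
        ring

lemma lintegral_freqWeight_mul_schwartz_lt_top (σ : ℝ) (φ : 𝓢(ℝ, ℂ)) :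
    ∫⁻ ξ, freqWeight σ ξ * ‖φ ξ‖ₑ < ⊤ := by
  obtain ⟨n, hn⟩ := exists_nat_ge σ
  have hi : Integrable fun ξ : ℝ => 2 ^ (n - 1) * (‖φ ξ‖ + (2 * Real.pi) ^ n * (‖ξ‖ ^ n * ‖φ ξ‖)) :=
    (φ.integrable.norm.add ((φ.integrable_pow_mul volume n).const_mul _)).const_mul _
  refine lt_of_le_of_lt (lintegral_mono fun ξ => ?_) hi.lintegral_lt_top
  rw [freqWeight, ← ofReal_norm, ← ENNReal.ofReal_mul
    (Real.rpow_nonneg (japaneseBracket_pos _).le _)]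
  refine ENNReal.ofReal_le_ofReal ?_
  have h1 : japaneseBracket (2 * Real.pi * ξ) ^ σ ≤ 2 ^ (n - 1) * (1 + (2 * Real.pi) ^ n * ‖ξ‖ ^ n) := by
    calc japaneseBracket (2 * Real.pi * ξ) ^ σ ≤ japaneseBracket (2 * Real.pi * ξ) ^ (n : ℝ) :=
          Real.rpow_le_rpow_of_exponent_le (one_le_japaneseBracket _) hn
      _ = (1 + |2 * Real.pi * ξ|) ^ n := by rw [Real.rpow_natCast, japaneseBracket]
      _ ≤ 2 ^ (n - 1) * (1 ^ n + |2 * Real.pi * ξ| ^ n) :=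
          add_pow_le zero_le_one (abs_nonneg _) n
      _ = _ := by rw [one_pow, abs_mul, abs_of_pos Real.two_pi_pos, mul_pow, Real.norm_eq_abs]
  calc _ ≤ 2 ^ (n - 1) * (1 + (2 * Real.pi) ^ n * ‖ξ‖ ^ n) * ‖φ ξ‖ := by gcongr
    _ = _ := by ring

lemma exists_schwartz_ofReal {η : ℝ → ℝ} (hη : ContDiff ℝ ∞ η) (hc : HasCompactSupport η) :
    ∃ ψ : 𝓢(ℝ, ℂ), ∀ x, ψ x = (η x : ℂ) :=
  exists_schwartz_eq (φ := Complex.ofRealCLM ∘ η) (by fun_prop) (hc.comp_left rfl)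

lemma memLp_schwartz_mul (ψ : 𝓢(ℝ, ℂ)) {u : ℝ → ℂ} (hu : MemLp u 2 volume) :
    MemLp (fun t => ψ t * u t) 2 volume := by
  exact MemLp.mul' (p := ⊤) (q := 2) hu (ψ.memLp_top volume)

/-- The transform of a product with a Schwartz function is dominated by a convolution. -/
lemma enorm_plancherel_mul_le {ψ : 𝓢(ℝ, ℂ)} (hψ : HasCompactSupport ψ) {u : ℝ → ℂ}
    (hu : MemLp u 2 volume) :
    ∀ᵐ ξ, ‖plancherel (fun t => ψ t * u t) ξ‖ₑ ≤
      ∫⁻ ζ, ‖(𝓕 ψ) (ξ - ζ)‖ₑ * ‖plancherel u ζ‖ₑ := by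
  have hL2 := memLp_schwartz_mul ψ hu
  have hi : Integrable (fun t => ψ t * u t) := (ψ.memLp 2 volume).integrable_mul hu
  filter_upwards [plancherel_eq_fourier hL2 hi] with ξ hξ
  -- The inverse transform of this modulation of `ψ` at `ζ` is `(𝓕 ψ) (ξ - ζ)`, so duality yields
  -- the convolution formula.
  obtain ⟨χ, hχ⟩ := exists_schwartz_eq
    (φ := fun t : ℝ => Complex.exp (-2 * Real.pi * Complex.I * ξ * t) * ψ t)
    (by
      have h1 : ContDiff ℝ ∞ ψ := ψ.smooth ⊤
      have h2 : ContDiff ℝ ∞ fun t : ℝ => Complex.exp (-2 * Real.pi * Complex.I * ξ * t) := by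
        have : ContDiff ℝ ∞ fun t : ℝ => (t : ℂ) := Complex.ofRealCLM.contDiff
        fun_prop
      exact h2.mul h1) hψ.mul_left
  have e1 := integral_mul_plancherel hu (𝓕⁻ χ)
  rw [fourier_fourierInv_eq] at e1
  have e2 : ∀ ζ, (𝓕⁻ χ) ζ = (𝓕 ψ) (ξ - ζ) := by
    intro ζ
    rw [SchwartzMap.fourierInv_coe, SchwartzMap.fourier_coe, fourierInv_eq_integral,
      Real.fourier_real_eq_integral_exp_smul]
    congr 1
    ext t
    rw [hχ, smul_eq_mul, ← mul_assoc, ← Complex.exp_add]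
    congr 2
    push_cast
    ring
  have e3 : 𝓕 (fun t => ψ t * u t) ξ = ∫ ζ, (𝓕 ψ) (ξ - ζ) * plancherel u ζ := by
    simp_rw [e2] at e1
    rw [e1, Real.fourier_real_eq_integral_exp_smul]
    congr 1
    ext t
    rw [hχ, smul_eq_mul, ← mul_assoc (Complex.exp _)]
    congr 3
    push_cast
    ring
  rw [hξ, e3]
  refine (enorm_integral_le_lintegral_enorm _).trans (le_of_eq ?_)
  simp_rw [enorm_mul]

/-- Multiplication by a test function is bounded on `H^σ(ℝ)`, `σ ≥ 0`. -/
theorem sobolevNorm_mul_le {σ : ℝ} (hσ : 0 ≤ σ) {η : ℝ → ℝ} (hη : ContDiff ℝ ∞ η)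
    (hc : HasCompactSupport η) :
    ∃ C : ℝ≥0, ∀ u : ℝ → ℂ, MemLp u 2 volume →
      sobolevNorm σ (fun t => (η t : ℂ) * u t) ≤ C * sobolevNorm σ u := by
  obtain ⟨ψ, hψ⟩ := exists_schwartz_ofReal hη hc
  have hψc : HasCompactSupport ψ := by
    have : (ψ : ℝ → ℂ) = Complex.ofRealCLM ∘ η := funext hψ
    rw [this]
    exact hc.comp_left rfl
  let Φ : 𝓢(ℝ, ℂ) := 𝓕 ψ
  have hK := lintegral_freqWeight_mul_schwartz_lt_top σ Φ
  set K := ∫⁻ ξ, freqWeight σ ξ * ‖Φ ξ‖ₑ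
  refine ⟨NNReal.sqrt (K ^ 2).toNNReal, fun u hu => ?_⟩
  simp_rw [← hψ]
  refine sobolevNorm_le_of_sq_le (memLp_schwartz_mul ψ hu) hu ?_
  rw [ENNReal.coe_toNNReal (by finiteness)]
  have hw := measurable_freqWeight σ
  have hmu := measurable_plancherel u
  have hΦ : Measurable Φ := Φ.continuous.measurable
  refine le_trans (lintegral_mono_ae ?_) (lintegral_convolution_sq_le
    (k := fun ξ => freqWeight σ ξ * ‖Φ ξ‖ₑ) (v := fun ζ => freqWeight σ ζ * ‖plancherel u ζ‖ₑ)
    (by fun_prop) (by fun_prop))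
  filter_upwards [enorm_plancherel_mul_le hψc hu] with ξ hξ
  refine pow_le_pow_left' ((mul_le_mul_right hξ _).trans ?_) 2
  rw [← lintegral_const_mul' _ _ (by exact ENNReal.ofReal_ne_top)]
  refine lintegral_mono fun ζ => ?_
  have h1 := freqWeight_add_le hσ (ξ - ζ) ζ
  rw [sub_add_cancel] at h1
  refine (mul_le_mul_left h1 _).trans (le_of_eq ?_)
  change _ = freqWeight σ (ξ - ζ) * ‖(𝓕 ψ) (ξ - ζ)‖ₑ * _
  ring

/-! ### The multiplier of the boundary term. -/

/-- The spatial profile `e^{-(√3/2 + i/2) y} ρ(y)` of the boundary term. -/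
def boundaryProfile (ρ : ℝ → ℝ) (y : ℝ) : ℂ :=
  Complex.exp ((-((Real.sqrt 3 / 2 : ℝ) : ℂ) - (1 / 2 : ℂ) * Complex.I) * (y : ℂ)) * (ρ y : ℂ)

/-- The transform in time of the boundary term at `x`. -/
def boundaryFreq (ρ : ℝ → ℝ) (h : ℝ → ℂ) (x : ℝ) : ℝ → ℂ :=
  (Ioi (0 : ℝ)).indicator fun ξ =>
    boundaryProfile ρ ((2 * Real.pi * ξ) ^ (1 / 3 : ℝ) * x) *
      plancherel ((Ici (0 : ℝ)).indicator h) ξ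

lemma continuous_boundaryProfile {ρ : ℝ → ℝ} (hρ : ContDiff ℝ ∞ ρ) :
    Continuous (boundaryProfile ρ) := by
  have := hρ.continuous
  unfold boundaryProfile
  fun_prop

lemma norm_boundaryProfile (ρ : ℝ → ℝ) (y : ℝ) :
    ‖boundaryProfile ρ y‖ = Real.exp (-(Real.sqrt 3 / 2) * y) * |ρ y| := by
  rw [boundaryProfile, norm_mul, Complex.norm_exp, Complex.norm_real, Real.norm_eq_abs]
  congr 2
  simp

/-- Compactness handles `[-2, 0]`, the support of `ρ` the left, and `e^z ≥ z³/3!` the right. The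
cube is chosen because `|y|³` is linear in `ξ` for `y = (2πξ)^{1/3} x`. -/
lemma exists_boundaryProfile_bound {ρ : ℝ → ℝ} (hρ : ContDiff ℝ ∞ ρ)
    (hs : Function.support ρ ⊆ Ioi (-2)) (h1 : ∀ y : ℝ, 0 ≤ y → ρ y = 1) :
    ∃ A : ℝ≥0, ∀ y, ‖boundaryProfile ρ y‖ * (1 + |y| ^ 3) ≤ A := by
  have hcont : Continuous fun y => ‖boundaryProfile ρ y‖ * (1 + |y| ^ 3) := by
    have := continuous_boundaryProfile hρ
    fun_prop
  obtain ⟨B, hB⟩ := (isCompact_Icc (a := (-2 : ℝ)) (b := 0)).bddAbove_image hcont.continuousOn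
  have hB' : ∀ y ∈ Icc (-2 : ℝ) 0, ‖boundaryProfile ρ y‖ * (1 + |y| ^ 3) ≤ B := fun y hy =>
    hB (mem_image_of_mem _ hy)
  set a := Real.sqrt 3 / 2 with ha
  have ha0 : 0 < a := by positivity
  have hB0 : 0 ≤ B := le_trans (by positivity) (hB' 0 (by norm_num))
  refine ⟨Real.toNNReal (B + (1 + 6 / a ^ 3)), fun y => ?_⟩
  rw [Real.coe_toNNReal _ (by positivity)]
  rcases le_or_gt y 0 with hy | hy
  · rcases le_or_gt (-2) y with hy2 | hy2
    · refine (hB' y ⟨hy2, hy⟩).trans ?_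
      have : 0 ≤ 1 + 6 / a ^ 3 := by positivity
      linarith
    · have : ρ y = 0 := by
        by_contra hne
        have : -2 < y := hs hne
        linarith
      rw [norm_boundaryProfile, this]
      simp only [abs_zero, mul_zero, zero_mul]
      positivity
  · rw [norm_boundaryProfile, h1 y hy.le, abs_of_pos hy, abs_one, mul_one, ← ha]
    have h3 := Real.pow_div_factorial_le_exp (a * y) (by positivity) 3
    have hexp : Real.exp (-a * y) * Real.exp (a * y) = 1 := by
      rw [← Real.exp_add]; simp
    have hle : Real.exp (-a * y) ≤ 1 := Real.exp_le_one_iff.2 (by nlinarith)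
    have hcube : Real.exp (-a * y) * y ^ 3 ≤ 6 / a ^ 3 := by
      rw [le_div_iff₀ (by positivity)]
      have h4 : (a * y) ^ 3 ≤ 6 * Real.exp (a * y) := by
        simp [Nat.factorial] at h3
        linarith
      calc Real.exp (-a * y) * y ^ 3 * a ^ 3 = Real.exp (-a * y) * (a * y) ^ 3 := by ring
        _ ≤ Real.exp (-a * y) * (6 * Real.exp (a * y)) := by gcongr
        _ = 6 := by linear_combination 6 * hexp
    linarith

lemma norm_boundaryProfile_le {ρ : ℝ → ℝ} {A : ℝ≥0}
    (hA : ∀ y, ‖boundaryProfile ρ y‖ * (1 + |y| ^ 3) ≤ A) (y : ℝ) :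
    ‖boundaryProfile ρ y‖ ≤ A :=
  le_trans (le_mul_of_one_le_right (norm_nonneg _) (by linarith [pow_nonneg (abs_nonneg y) 3]))
    (hA y)

section Frequency

variable {ρ : ℝ → ℝ} {h : ℝ → ℂ} {A : ℝ≥0}

lemma measurable_boundaryFreq (hρ : ContDiff ℝ ∞ ρ) (h : ℝ → ℂ) (x : ℝ) :
    Measurable (boundaryFreq ρ h x) := by
  have h1 := (continuous_boundaryProfile hρ).measurable
  have h2 := measurable_plancherel ((Ici (0 : ℝ)).indicator h)
  unfold boundaryFreq
  exact Measurable.indicator (by fun_prop) measurableSet_Ioi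

lemma enorm_boundaryFreq_le (hA : ∀ y, ‖boundaryProfile ρ y‖ * (1 + |y| ^ 3) ≤ A)
    (x ξ : ℝ) :
    ‖boundaryFreq ρ h x ξ‖ₑ ≤ A * ‖plancherel ((Ici (0 : ℝ)).indicator h) ξ‖ₑ := by
  refine (enorm_indicator_le_enorm_self _ _).trans ?_
  rw [enorm_mul]
  gcongr
  exact_mod_cast norm_boundaryProfile_le hA _

lemma memLp_boundaryFreq (hρ : ContDiff ℝ ∞ ρ)
    (hA : ∀ y, ‖boundaryProfile ρ y‖ * (1 + |y| ^ 3) ≤ A) (x : ℝ) :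
    MemLp (boundaryFreq ρ h x) 2 volume := by
  rw [memLp_two_iff_lintegral (measurable_boundaryFreq hρ h x).aestronglyMeasurable]
  have h2 := (memLp_two_iff_lintegral
    (memLp_plancherel ((Ici (0 : ℝ)).indicator h)).1).1 (memLp_plancherel _)
  refine (lintegral_mono fun ξ => pow_le_pow_left' (enorm_boundaryFreq_le hA x ξ) 2).trans_lt ?_
  simp_rw [mul_pow]
  rw [lintegral_const_mul' _ _ (by finiteness)]
  finiteness

lemma integrable_boundaryFreq_of_integrable (hρ : ContDiff ℝ ∞ ρ)
    (hA : ∀ y, ‖boundaryProfile ρ y‖ * (1 + |y| ^ 3) ≤ A)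
    (hi : Integrable (plancherel ((Ici (0 : ℝ)).indicator h))) (x : ℝ) :
    Integrable (boundaryFreq ρ h x) := by
  refine ⟨(measurable_boundaryFreq hρ h x).aestronglyMeasurable, ?_⟩
  rw [hasFiniteIntegral_iff_enorm]
  refine (lintegral_mono (enorm_boundaryFreq_le hA x)).trans_lt ?_
  rw [lintegral_const_mul' _ _ (by finiteness)]
  exact ENNReal.mul_lt_top (by finiteness) hi.2

/-- For `x ≠ 0` the multiplier is `O((1 + c|ξ|)⁻¹)` with `c = 2π|x|³`, a square integrable function;
Cauchy–Schwarz against the `L²` transform does the rest. -/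
lemma integrable_boundaryFreq_of_ne_zero (hρ : ContDiff ℝ ∞ ρ)
    (hA : ∀ y, ‖boundaryProfile ρ y‖ * (1 + |y| ^ 3) ≤ A) {x : ℝ} (hx : x ≠ 0) :
    Integrable (boundaryFreq ρ h x) := by
  refine ⟨(measurable_boundaryFreq hρ h x).aestronglyMeasurable, ?_⟩
  rw [hasFiniteIntegral_iff_enorm]
  set H := (Ici (0 : ℝ)).indicator h
  have hm := measurable_plancherel H
  set c := 2 * Real.pi * |x| ^ 3 with hc
  have hc0 : 0 < c := by have := abs_pos.2 hx; positivity
  have hpt : ∀ ξ, ‖boundaryFreq ρ h x ξ‖ₑ ≤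
      ENNReal.ofReal (A * (1 + ‖c * ξ‖) ^ (-1 : ℝ)) * ‖plancherel H ξ‖ₑ := by
    intro ξ
    by_cases hξ : ξ ∈ Ioi (0 : ℝ)
    · have hξ0 : 0 < ξ := hξ
      rw [boundaryFreq, indicator_of_mem hξ, enorm_mul]
      gcongr
      rw [← ofReal_norm]
      refine ENNReal.ofReal_le_ofReal ?_
      have h1 := hA ((2 * Real.pi * ξ) ^ (1 / 3 : ℝ) * x)
      have h2 : |(2 * Real.pi * ξ) ^ (1 / 3 : ℝ) * x| ^ 3 = ‖c * ξ‖ := by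
        rw [abs_mul, mul_pow, abs_of_pos (by positivity), ← Real.rpow_natCast, ← Real.rpow_mul
          (by positivity), Real.norm_of_nonneg (by positivity), hc]
        norm_num
        ring
      rw [h2] at h1
      rw [Real.rpow_neg_one, ← div_eq_mul_inv, le_div_iff₀ (by positivity)]
      exact h1
    · rw [boundaryFreq, indicator_of_notMem hξ]
      simp
  refine (lintegral_mono hpt).trans_lt ?_
  have hsq : (∫⁻ ξ, ENNReal.ofReal (A * (1 + ‖c * ξ‖) ^ (-1 : ℝ)) * ‖plancherel H ξ‖ₑ) ^ 2 < ⊤ := by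
    refine (lintegral_mul_sq_le volume (by fun_prop) (by fun_prop)).trans_lt ?_
    refine ENNReal.mul_lt_top ?_
      ((memLp_two_iff_lintegral (memLp_plancherel H).1).1 (memLp_plancherel H))
    rw [lintegral_comp_mul_left hc0 fun u => ENNReal.ofReal (A * (1 + ‖u‖) ^ (-1 : ℝ)) ^ 2]
    refine ENNReal.mul_lt_top ENNReal.ofReal_lt_top ?_
    have hi : Integrable fun u : ℝ => (A : ℝ) ^ 2 * (1 + ‖u‖) ^ (-2 : ℝ) :=
      (integrable_one_add_norm (by simp)).const_mul _
    refine lt_of_le_of_lt (le_of_eq (lintegral_congr fun u => ?_)) hi.lintegral_lt_top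
    rw [← ENNReal.ofReal_pow (by positivity), mul_pow, ← Real.rpow_natCast ((1 + ‖u‖) ^ (-1 : ℝ)),
      ← Real.rpow_mul (by positivity)]
    norm_num
  by_contra hcon
  rw [not_lt, top_le_iff] at hcon
  rw [hcon] at hsq
  simp at hsq

/-! ### From the frequency `β` to the Fourier variable. -/

/-- The change of variables `ξ = β³ / 2π`. -/
lemma hasDerivAt_cube_div (β : ℝ) :
    HasDerivAt (fun β : ℝ => β ^ 3 / (2 * Real.pi)) (3 * β ^ 2 / (2 * Real.pi)) β := by
  have := (hasDerivAt_pow 3 β).div_const (2 * Real.pi)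
  simpa using this

lemma injOn_cube_div (S : Set ℝ) : InjOn (fun β : ℝ => β ^ 3 / (2 * Real.pi)) S := by
  intro a _ b _ hab
  have h1 : a ^ 3 = b ^ 3 := by
    have h2 := Real.two_pi_pos.ne'
    have h3 : a ^ 3 / (2 * Real.pi) = b ^ 3 / (2 * Real.pi) := hab
    field_simp at h3
    exact h3
  exact (Odd.strictMono_pow (by decide : Odd 3)).injective h1

lemma cube_div_rpow {β : ℝ} (hβ : 0 < β) :
    (2 * Real.pi * (β ^ 3 / (2 * Real.pi))) ^ (1 / 3 : ℝ) = β := by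
  rw [mul_div_cancel₀ _ Real.two_pi_pos.ne', ← Real.rpow_natCast, ← Real.rpow_mul hβ.le]
  norm_num

lemma image_cube_div_Ioi : (fun β : ℝ => β ^ 3 / (2 * Real.pi)) '' Ioi 0 = Ioi 0 := by
  ext ξ
  constructor
  · rintro ⟨β, hβ, rfl⟩
    have hβ0 : 0 < β := hβ
    simp only [mem_Ioi]
    positivity
  · intro hξ
    have hξ0 : 0 < ξ := hξ
    refine ⟨(2 * Real.pi * ξ) ^ (1 / 3 : ℝ), by simp only [mem_Ioi]; positivity, ?_⟩
    simp only
    rw [← Real.rpow_natCast, ← Real.rpow_mul (by positivity)]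
    norm_num

lemma image_cube_div_Ioc (R : ℝ) :
    (fun β : ℝ => β ^ 3 / (2 * Real.pi)) '' Ioc 0 R = Ioc 0 (R ^ 3 / (2 * Real.pi)) := by
  have hmono : StrictMono fun β : ℝ => β ^ 3 / (2 * Real.pi) := fun a b hab =>
    div_lt_div_of_pos_right (Odd.strictMono_pow (by decide : Odd 3) hab) Real.two_pi_pos
  ext ξ
  constructor
  · rintro ⟨β, hβ, rfl⟩
    have hβ0 : 0 < β := hβ.1
    exact ⟨by positivity, hmono.monotone hβ.2⟩
  · intro hξ
    obtain ⟨β, hβ, rfl⟩ := image_cube_div_Ioi.superset (show ξ ∈ Ioi 0 from hξ.1)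
    exact ⟨β, ⟨hβ, hmono.le_iff_le.1 hξ.2⟩, rfl⟩

/-- The Jacobian `3β²/2π` supplies exactly the prefactor `3/2π` and the factor `β²`. -/
lemma boundaryIntegrand_eq (ρ : ℝ → ℝ) (h : ℝ → ℂ) (x t : ℝ) {β : ℝ} (hβ : 0 < β) :
    |3 * β ^ 2 / (2 * Real.pi)| • (Complex.exp (((2 * Real.pi * (t * (β ^ 3 / (2 * Real.pi))) : ℝ)
      : ℂ) * Complex.I) * boundaryFreq ρ h x (β ^ 3 / (2 * Real.pi))) =
      (3 / (2 * (Real.pi : ℂ))) * boundaryIntegrand ρ h x t β := by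
  have hpos : 0 < β ^ 3 / (2 * Real.pi) := by positivity
  rw [abs_of_pos (by positivity), boundaryFreq, indicator_of_mem (show _ ∈ Ioi (0 : ℝ) from hpos),
    cube_div_rpow hβ, boundaryProfile, boundaryIntegrand, boundaryTransform,
    fourierL2_eq_plancherel, Complex.real_smul]
  have e1 : (((2 * Real.pi * (t * (β ^ 3 / (2 * Real.pi))) : ℝ) : ℂ) * Complex.I) =
      Complex.I * (β : ℂ) ^ 3 * (t : ℂ) := by
    have : 2 * Real.pi * (t * (β ^ 3 / (2 * Real.pi))) = β ^ 3 * t := by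
      field_simp
    rw [this]
    push_cast
    ring
  have e2 : (-((Real.sqrt 3 / 2 : ℝ) : ℂ) - (1 / 2 : ℂ) * Complex.I) * ((β * x : ℝ) : ℂ) =
      (β : ℂ) * (-((Real.sqrt 3 / 2 : ℝ) : ℂ) - (1 / 2 : ℂ) * Complex.I) * (x : ℂ) := by
    push_cast
    ring
  rw [e1, e2]
  push_cast
  ring

lemma boundaryIntegral_eq (ρ : ℝ → ℝ) (h : ℝ → ℂ) (x t : ℝ) {S : Set ℝ} (hS : MeasurableSet S)
    (hS0 : S ⊆ Ioi 0) :
    boundaryIntegral ρ h S x t =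
      ∫ ξ in (fun β : ℝ => β ^ 3 / (2 * Real.pi)) '' S,
        Complex.exp (((2 * Real.pi * (t * ξ) : ℝ) : ℂ) * Complex.I) * boundaryFreq ρ h x ξ := by
  rw [integral_image_eq_integral_abs_deriv_smul hS
    (fun β _ => (hasDerivAt_cube_div β).hasDerivWithinAt) (injOn_cube_div S), boundaryIntegral,
    ← integral_const_mul]
  exact setIntegral_congr_fun hS fun β hβ => (boundaryIntegrand_eq ρ h x t (hS0 hβ)).symm

lemma integrableOn_boundaryIntegrand (x t : ℝ) (hi : Integrable (boundaryFreq ρ h x)) :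
    IntegrableOn (boundaryIntegrand ρ h x t) (Ioi 0) := by
  have h1 := (integrable_exp_mul hi t).integrableOn (s := (fun β : ℝ => β ^ 3 / (2 * Real.pi)) ''
    Ioi 0)
  rw [integrableOn_image_iff_integrableOn_abs_deriv_smul measurableSet_Ioi
    (fun β _ => (hasDerivAt_cube_div β).hasDerivWithinAt) (injOn_cube_div _)] at h1
  have h2 := h1.congr_fun (fun β hβ => boundaryIntegrand_eq ρ h x t hβ) measurableSet_Ioi
  have h3 := h2.const_mul ((3 / (2 * (Real.pi : ℂ)))⁻¹)
  refine h3.congr (.of_forall fun β => ?_)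
  have : (3 / (2 * (Real.pi : ℂ))) ≠ 0 := by
    simp [Real.pi_ne_zero]
  simp only
  rw [← mul_assoc, inv_mul_cancel₀ this, one_mul]

lemma boundaryIntegral_Ioi (ρ : ℝ → ℝ) (h : ℝ → ℂ) (x : ℝ) :
    boundaryIntegral ρ h (Ioi 0) x = 𝓕⁻ (boundaryFreq ρ h x) := by
  ext t
  rw [boundaryIntegral_eq ρ h x t measurableSet_Ioi subset_rfl, image_cube_div_Ioi,
    fourierInv_eq_integral, ← integral_indicator measurableSet_Ioi]
  congr 1
  ext ξ
  by_cases hξ : ξ ∈ Ioi (0 : ℝ)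
  · rw [indicator_of_mem hξ]
  · rw [indicator_of_notMem hξ, boundaryFreq, indicator_of_notMem hξ, mul_zero]

/-! ### The boundary term as an `L²` limit, its norm and its continuity. -/

/-- The truncation of the transform to the frequencies `β ≤ R`. -/
def truncatedFreq (ρ : ℝ → ℝ) (h : ℝ → ℂ) (x R : ℝ) : ℝ → ℂ :=
  (Ioc 0 (R ^ 3 / (2 * Real.pi))).indicator (boundaryFreq ρ h x)

lemma boundaryIntegral_Ioc (ρ : ℝ → ℝ) (h : ℝ → ℂ) (x R : ℝ) :
    boundaryIntegral ρ h (Ioc 0 R) x = 𝓕⁻ (truncatedFreq ρ h x R) := by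
  ext t
  rw [boundaryIntegral_eq ρ h x t measurableSet_Ioc Ioc_subset_Ioi_self, image_cube_div_Ioc,
    fourierInv_eq_integral, ← integral_indicator measurableSet_Ioc]
  congr 1
  ext ξ
  unfold truncatedFreq
  by_cases hξ : ξ ∈ Ioc 0 (R ^ 3 / (2 * Real.pi))
  · rw [indicator_of_mem hξ, indicator_of_mem hξ]
  · rw [indicator_of_notMem hξ, indicator_of_notMem hξ, mul_zero]

lemma memLp_truncatedFreq (hF : MemLp (boundaryFreq ρ h x) 2 volume) (R : ℝ) :
    MemLp (truncatedFreq ρ h x R) 2 volume := hF.indicator measurableSet_Ioc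

lemma integrable_truncatedFreq {x : ℝ} (hF : MemLp (boundaryFreq ρ h x) 2 volume) (R : ℝ) :
    Integrable (truncatedFreq ρ h x R) := by
  rw [truncatedFreq, integrable_indicator_iff measurableSet_Ioc]
  exact (hF.locallyIntegrable (by norm_num)).integrableOn_isCompact isCompact_Icc |>.mono_set
    Ioc_subset_Icc_self

lemma tendsto_zero_of_sq {ι : Type*} {l : Filter ι} {a : ι → ℝ≥0∞}
    (h : Tendsto (fun i => a i ^ 2) l (𝓝 0)) : Tendsto a l (𝓝 0) := by
  have h1 := h.ennrpow_const (1 / 2 : ℝ)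
  rw [ENNReal.zero_rpow_of_pos (by norm_num)] at h1
  refine h1.congr fun i => ?_
  rw [← ENNReal.rpow_natCast, ← ENNReal.rpow_mul]
  norm_num

lemma tendsto_truncatedFreq {x : ℝ} (hF : MemLp (boundaryFreq ρ h x) 2 volume)
    (hFm : Measurable (boundaryFreq ρ h x)) :
    Tendsto (fun R => eLpNorm (boundaryFreq ρ h x - truncatedFreq ρ h x R) 2 volume)
      atTop (𝓝 0) := by
  refine tendsto_zero_of_sq ?_
  simp_rw [eLpNorm_two_sq]
  rw [← lintegral_zero (μ := (volume : Measure ℝ))]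
  refine tendsto_lintegral_filter_of_dominated_convergence
    (fun ξ => ‖boundaryFreq ρ h x ξ‖ₑ ^ 2) (.of_forall fun R => ?_)
    (.of_forall fun R => .of_forall fun ξ => ?_)
    ((memLp_two_iff_lintegral hF.1).1 hF).ne (.of_forall fun ξ => ?_)
  · have : Measurable (truncatedFreq ρ h x R) := hFm.indicator measurableSet_Ioc
    simp only [Pi.sub_apply]
    fun_prop
  · refine pow_le_pow_left' ?_ 2
    rw [truncatedFreq, ← indicator_compl]
    exact enorm_indicator_le_enorm_self _ _
  · refine tendsto_const_nhds.congr' ?_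
    have hlim : Tendsto (fun R : ℝ => R ^ 3 / (2 * Real.pi)) atTop atTop :=
      (tendsto_pow_atTop (by norm_num)).atTop_div_const Real.two_pi_pos
    filter_upwards [hlim.eventually_ge_atTop ξ] with R hR
    rw [Pi.sub_apply, truncatedFreq]
    by_cases hξ : 0 < ξ
    · rw [indicator_of_mem (show ξ ∈ Ioc 0 (R ^ 3 / (2 * Real.pi)) from ⟨hξ, hR⟩)]
      simp
    · have : boundaryFreq ρ h x ξ = 0 := indicator_of_notMem (by simpa using hξ) _
      rw [indicator_of_notMem (fun hh => hξ hh.1), this]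
      simp

/-- A function with the prescribed transform is the limit of the truncated boundary integrals. -/
lemma tendsto_boundaryIntegral {x : ℝ} {U : ℝ → ℂ} (hU : MemLp U 2 volume)
    (hFm : Measurable (boundaryFreq ρ h x)) (hUF : plancherel U =ᵐ[volume] boundaryFreq ρ h x) :
    Tendsto (fun R : ℝ => eLpNorm (fun t => U t - boundaryIntegral ρ h (Ioc 0 R) x t) 2 volume)
      atTop (𝓝 0) := by
  have hF : MemLp (boundaryFreq ρ h x) 2 volume := (memLp_congr_ae hUF).1 (memLp_plancherel U)
  refine (tendsto_truncatedFreq hF hFm).congr fun R => ?_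
  -- The truncated transform is integrable, so `v` is the truncated integral almost everywhere;
  -- Plancherel then turns the error into the tail of the transform.
  obtain ⟨v, hv, hvF⟩ := exists_plancherel_eq (memLp_truncatedFreq hF R)
  have hvi : v =ᵐ[volume] boundaryIntegral ρ h (Ioc 0 R) x := by
    rw [boundaryIntegral_Ioc]
    have h1 := eq_fourierInv_plancherel hv ((integrable_truncatedFreq hF R).congr hvF.symm)
    filter_upwards [h1] with t ht
    rw [ht, Real.fourierInv_congr_ae hvF]
  have h2 : (fun t => U t - boundaryIntegral ρ h (Ioc 0 R) x t) =ᵐ[volume] U - v := by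
    filter_upwards [hvi] with t ht
    rw [Pi.sub_apply, ht]
  rw [eLpNorm_congr_ae h2, ← eLpNorm_plancherel (hU.sub hv)]
  refine eLpNorm_congr_ae ?_
  filter_upwards [plancherel_sub hU hv, hUF, hvF] with ξ h3 h4 h5
  rw [h3, Pi.sub_apply, Pi.sub_apply, h4, h5]

lemma ae_eq_of_tendsto_eLpNorm_sub {U V : ℝ → ℂ} {w : ℝ → ℝ → ℂ} (hU : MemLp U 2 volume)
    (hV : MemLp V 2 volume) (hw : ∀ R, AEStronglyMeasurable (w R) volume)
    (h1 : Tendsto (fun R : ℝ => eLpNorm (fun t => U t - w R t) 2 volume) atTop (𝓝 0))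
    (h2 : Tendsto (fun R : ℝ => eLpNorm (fun t => V t - w R t) 2 volume) atTop (𝓝 0)) :
    U =ᵐ[volume] V := by
  have h3 := h1.add h2
  rw [add_zero] at h3
  have h4 : eLpNorm (U - V) 2 volume = 0 := by
    refine le_antisymm (ge_of_tendsto' h3 fun R => ?_) zero_le
    have e : U - V = (fun t => U t - w R t) - fun t => V t - w R t := by ext t; simp
    rw [e]
    exact eLpNorm_sub_le (hU.1.sub (hw R)) (hV.1.sub (hw R)) (by norm_num)
  rw [eLpNorm_eq_zero_iff (hU.1.sub hV.1) (by norm_num)] at h4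
  filter_upwards [h4] with t ht
  exact sub_eq_zero.1 ht

/-- The transform of the boundary term. -/
lemma IsBoundaryTerm.plancherel_ae_eq (hρ : ContDiff ℝ ∞ ρ)
    (hA : ∀ y, ‖boundaryProfile ρ y‖ * (1 + |y| ^ 3) ≤ A) {u : ℝ → ℝ → ℂ}
    (hu : IsBoundaryTerm ρ h u) (x : ℝ) :
    plancherel (u x) =ᵐ[volume] boundaryFreq ρ h x := by
  have hF := memLp_boundaryFreq (h := h) hρ hA x
  obtain ⟨U, hU, hUF⟩ := exists_plancherel_eq hF
  have hm : ∀ R, AEStronglyMeasurable (fun t => boundaryIntegral ρ h (Ioc 0 R) x t) volume := by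
    intro R
    rw [show (fun t => boundaryIntegral ρ h (Ioc 0 R) x t) = 𝓕⁻ (truncatedFreq ρ h x R) from
      boundaryIntegral_Ioc ρ h x R]
    exact (continuous_fourierInv (integrable_truncatedFreq hF R)).aestronglyMeasurable
  have h1 := ae_eq_of_tendsto_eLpNorm_sub (hu x).1 hU hm (hu x).2
    (tendsto_boundaryIntegral hU (measurable_boundaryFreq hρ h x) hUF)
  rw [plancherel_congr h1]
  exact hUF

lemma exists_isBoundaryTerm (hρ : ContDiff ℝ ∞ ρ)
    (hA : ∀ y, ‖boundaryProfile ρ y‖ * (1 + |y| ^ 3) ≤ A) :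
    ∃ u : ℝ → ℝ → ℂ, IsBoundaryTerm ρ h u := by
  choose U hU hUF using fun x => exists_plancherel_eq (memLp_boundaryFreq (h := h) hρ hA x)
  exact ⟨U, fun x => ⟨hU x, tendsto_boundaryIntegral (hU x) (measurable_boundaryFreq hρ h x)
    (hUF x)⟩⟩

lemma IsBoundaryTerm.ae_eq_boundaryIntegral (hρ : ContDiff ℝ ∞ ρ)
    (hA : ∀ y, ‖boundaryProfile ρ y‖ * (1 + |y| ^ 3) ≤ A) {u : ℝ → ℝ → ℂ}
    (hu : IsBoundaryTerm ρ h u) {x : ℝ} (hi : Integrable (boundaryFreq ρ h x)) :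
    ∀ᵐ t, u x t = boundaryIntegral ρ h (Ioi 0) x t := by
  have h1 := hu.plancherel_ae_eq hρ hA x
  rw [boundaryIntegral_Ioi]
  filter_upwards [eq_fourierInv_plancherel (hu x).1 (hi.congr h1.symm)] with t ht
  rw [ht, Real.fourierInv_congr_ae h1]

lemma IsBoundaryTerm.sobolevNorm_le (hρ : ContDiff ℝ ∞ ρ)
    (hA : ∀ y, ‖boundaryProfile ρ y‖ * (1 + |y| ^ 3) ≤ A) {u : ℝ → ℝ → ℂ}
    (hu : IsBoundaryTerm ρ h u) {σ : ℝ} (hH : MemLp ((Ici (0 : ℝ)).indicator h) 2 volume) (x : ℝ) :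
    sobolevNorm σ (u x) ≤ NNReal.sqrt (A ^ 2) * sobolevNorm σ ((Ici (0 : ℝ)).indicator h) := by
  refine sobolevNorm_le_of_sq_le (hu x).1 hH ?_
  rw [← lintegral_const_mul' _ _ (by simp)]
  refine lintegral_mono_ae ?_
  filter_upwards [hu.plancherel_ae_eq hρ hA x] with ξ hξ
  rw [hξ, ENNReal.coe_pow, ← mul_pow, mul_left_comm]
  exact pow_le_pow_left' (mul_le_mul_right (enorm_boundaryFreq_le hA x ξ) _) 2

/-- Dominated convergence on the Fourier side: the profile is continuous, and its bound `A` gives a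
majorant independent of `x`. -/
lemma IsBoundaryTerm.tendsto_sobolevNorm (hρ : ContDiff ℝ ∞ ρ)
    (hA : ∀ y, ‖boundaryProfile ρ y‖ * (1 + |y| ^ 3) ≤ A) {u : ℝ → ℝ → ℂ}
    (hu : IsBoundaryTerm ρ h u) {σ : ℝ} (hH : sobolevNorm σ ((Ici (0 : ℝ)).indicator h) ≠ ⊤)
    (x₀ : ℝ) :
    Tendsto (fun x => sobolevNorm σ (u x - u x₀)) (𝓝 x₀) (𝓝 0) := by
  set H := (Ici (0 : ℝ)).indicator h
  refine tendsto_zero_of_sq ?_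
  have hw := measurable_freqWeight σ
  have hP := measurable_plancherel H
  have e : ∀ x, sobolevNorm σ (u x - u x₀) ^ 2 = ENNReal.ofReal (2 * Real.pi) *
      ∫⁻ ξ, (freqWeight σ ξ * ‖boundaryFreq ρ h x ξ - boundaryFreq ρ h x₀ ξ‖ₑ) ^ 2 := by
    intro x
    rw [sobolevNorm_sq σ ((hu x).1.sub (hu x₀).1)]
    congr 1
    refine lintegral_congr_ae ?_
    filter_upwards [plancherel_sub (hu x).1 (hu x₀).1, hu.plancherel_ae_eq hρ hA x,
      hu.plancherel_ae_eq hρ hA x₀] with ξ h1 h2 h3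
    rw [h1, Pi.sub_apply, h2, h3]
  simp_rw [e]
  rw [← mul_zero (ENNReal.ofReal (2 * Real.pi))]
  refine ENNReal.Tendsto.const_mul ?_ (Or.inr ENNReal.ofReal_ne_top)
  rw [← lintegral_zero (μ := (volume : Measure ℝ))]
  refine tendsto_lintegral_filter_of_dominated_convergence
    (fun ξ => (2 * A) ^ 2 * (freqWeight σ ξ * ‖plancherel H ξ‖ₑ) ^ 2) (.of_forall fun x => ?_)
    (.of_forall fun x => .of_forall fun ξ => ?_) ?_ (.of_forall fun ξ => ?_)
  · have h1 := measurable_boundaryFreq hρ h x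
    have h2 := measurable_boundaryFreq hρ h x₀
    fun_prop
  · rw [← mul_pow, mul_left_comm]
    refine pow_le_pow_left' (mul_le_mul_right ?_ _) 2
    calc _ ≤ ‖boundaryFreq ρ h x ξ‖ₑ + ‖boundaryFreq ρ h x₀ ξ‖ₑ := enorm_sub_le
      _ ≤ A * ‖plancherel H ξ‖ₑ + A * ‖plancherel H ξ‖ₑ :=
        add_le_add (enorm_boundaryFreq_le hA x ξ) (enorm_boundaryFreq_le hA x₀ ξ)
      _ = _ := by ring
  · rw [lintegral_const_mul _ (by fun_prop)]
    have := lintegral_weighted_lt_top hH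
    finiteness
  · have hc : Continuous fun x => boundaryFreq ρ h x ξ := by
      have h1 := continuous_boundaryProfile hρ
      by_cases hξ : ξ ∈ Ioi (0 : ℝ)
      · simp only [boundaryFreq, indicator_of_mem hξ]
        fun_prop
      · simp only [boundaryFreq, indicator_of_notMem hξ]
        exact continuous_const
    have h2 : Tendsto (fun x => ‖boundaryFreq ρ h x ξ - boundaryFreq ρ h x₀ ξ‖ₑ) (𝓝 x₀)
        (𝓝 0) := by
      have h3 : Continuous fun x => ‖boundaryFreq ρ h x ξ - boundaryFreq ρ h x₀ ξ‖ₑ := by fun_prop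
      simpa using h3.tendsto x₀
    have h4 := ENNReal.Tendsto.const_mul (a := freqWeight σ ξ) h2
      (Or.inr ENNReal.ofReal_ne_top)
    rw [mul_zero] at h4
    simpa using h4.ennrpow_const 2

end Frequency

end

/-! ### Assembly of the proposition. -/

theorem proposition4p8
    (ρ : ℝ → ℝ) (hρ_smooth : ContDiff ℝ ∞ ρ) (hρ_supp : Function.support ρ ⊆ Ioi (-2))
    (hρ_one : ∀ y : ℝ, 0 ≤ y → ρ y = 1)
    (η : ℝ → ℝ) (hη_smooth : ContDiff ℝ ∞ η) (hη_supp : HasCompactSupport η)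
    (hη_one : ∀ t ∈ Icc (-1 : ℝ) 1, η t = 1)
    (s : ℝ) (hs_nonneg : 0 ≤ s) (hs_lt : s < 7 / 2) (hs_ne : s ≠ 1 / 2) :
    ∃ C : ℝ≥0, ∀ h : ℝ → ℂ, MemHalfLineSobolev ((s + 1) / 3) h →
      (1 / 2 < s → VanishesAtZero h) →
      (∃ u : ℝ → ℝ → ℂ, IsBoundaryTerm ρ h u) ∧
      ∀ u : ℝ → ℝ → ℂ, IsBoundaryTerm ρ h u →
        (∀ x : ℝ, x ≠ 0 ∨ 1 / 2 < s →
          (∀ t : ℝ, IntegrableOn (boundaryIntegrand ρ h x t) (Ioi 0)) ∧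
          ∀ᵐ t : ℝ, u x t = boundaryIntegral ρ h (Ioi 0) x t) ∧
        MemCxHt ((s + 1) / 3) (fun x t => (η t : ℂ) * u x t) ∧
        normCxHt ((s + 1) / 3) (fun x t => (η t : ℂ) * u x t)
          ≤ C * halfLineSobolevNorm ((s + 1) / 3) h := by
  -- The thresholds correspond: `s = 1/2` to `σ = 1/2`, and `s = 7/2` to `σ = 3/2`.
  set σ := (s + 1) / 3 with hσ
  have hσ0 : 0 < σ := by rw [hσ]; linarith
  have hσ2 : σ < 3 / 2 := by rw [hσ]; linarith
  have hσ1 : σ ≠ 1 / 2 := fun hcon => hs_ne (by rw [hσ] at hcon; linarith)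
  have hσs : 1 / 2 < σ → 1 / 2 < s := fun hh => by rw [hσ] at hh; linarith
  obtain ⟨A, hA⟩ := exists_boundaryProfile_bound hρ_smooth hρ_supp hρ_one
  obtain ⟨Cη, hCη⟩ := sobolevNorm_mul_le hσ0.le hη_smooth hη_supp
  obtain ⟨Cχ, hCχ⟩ := sobolevNorm_indicator_le hσ0 hσ2 hσ1
  -- The `+ 1` makes the constant nonzero, so that it passes through the infimum over extensions
  -- even where a norm is `⊤`.
  refine ⟨Cη * NNReal.sqrt (A ^ 2) * Cχ + 1, fun h hh hv => ?_⟩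
  have hv' : 1 / 2 < σ → VanishesAtZero h := fun hs => hv (hσs hs)
  obtain ⟨g₀, hg₀h, hg₀⟩ : ∃ g : ℝ → ℂ, g =ᵐ[volume.restrict (Ioi (0 : ℝ))] h ∧
      sobolevNorm σ g ≠ ⊤ := by
    by_contra hcon
    push Not at hcon
    exact hh (iInf₂_eq_top.2 hcon)
  set H := (Ici (0 : ℝ)).indicator h
  have hHσ : sobolevNorm σ H ≠ ⊤ :=
    ne_top_of_le_ne_top (by finiteness) (hCχ g₀ h hg₀ hg₀h hv')
  have hHL := memLp_of_sobolevNorm_ne_top hHσ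
  refine ⟨exists_isBoundaryTerm hρ_smooth hA, fun u hu => ⟨fun x hx => ?_, ⟨fun x => ?_,
    fun x₀ => ?_⟩, iSup_le fun x => ?_⟩⟩
  · have hi : Integrable (boundaryFreq ρ h x) := by
      rcases hx with hx | hs
      · exact integrable_boundaryFreq_of_ne_zero hρ_smooth hA hx
      · exact integrable_boundaryFreq_of_integrable hρ_smooth hA
          (integrable_plancherel (by rw [hσ]; linarith) hHσ) x
    exact ⟨fun t => integrableOn_boundaryIntegrand x t hi,
      hu.ae_eq_boundaryIntegral hρ_smooth hA hi⟩
  · refine ne_top_of_le_ne_top ?_ ((hCη (u x) (hu x).1).trans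
      (mul_le_mul_right (hu.sobolevNorm_le hρ_smooth hA hHL x) _))
    finiteness
  · have h1 := ENNReal.Tendsto.const_mul (a := (Cη : ℝ≥0∞))
      (hu.tendsto_sobolevNorm hρ_smooth hA hHσ x₀) (Or.inr ENNReal.coe_ne_top)
    rw [mul_zero] at h1
    refine tendsto_of_tendsto_of_tendsto_of_le_of_le tendsto_const_nhds h1 (fun _ => zero_le)
      fun x => ?_
    have h2 := hCη (u x - u x₀) ((hu x).1.sub (hu x₀).1)
    simpa only [Pi.sub_apply, mul_sub] using h2
  · have hpos : ((Cη * NNReal.sqrt (A ^ 2) * Cχ + 1 : ℝ≥0) : ℝ≥0∞) ≠ 0 := by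
      simp
    unfold halfLineSobolevNorm
    rw [ENNReal.mul_iInf_of_ne hpos ENNReal.coe_ne_top]
    -- The restriction bound holds for every extension `g` of the same `h`, whereas the left side
    -- depends on `h` alone.
    refine le_iInf fun g => ?_
    rw [ENNReal.mul_iInf_of_ne hpos ENNReal.coe_ne_top]
    refine le_iInf fun hgh => ?_
    rcases eq_or_ne (sobolevNorm σ g) ⊤ with hg | hg
    · rw [hg, ENNReal.mul_top hpos]
      exact le_top
    calc sobolevNorm σ (fun t => (η t : ℂ) * u x t)
        ≤ Cη * (NNReal.sqrt (A ^ 2) * (Cχ * sobolevNorm σ g)) :=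
          (hCη (u x) (hu x).1).trans (mul_le_mul_right ((hu.sobolevNorm_le hρ_smooth hA hHL x).trans
            (mul_le_mul_right (hCχ g h hg hgh hv') _)) _)
      _ = ((Cη * NNReal.sqrt (A ^ 2) * Cχ : ℝ≥0) : ℝ≥0∞) * sobolevNorm σ g := by
          push_cast
          ring
      _ ≤ _ := by
          gcongr
          exact le_self_add
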